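/- Let $\varphi$ be a formula of the two-variable guarded fragment with counting quantifiers $\mathcal{GC}^2$, over a finite signature of unary and binary predicates, in the normal form $$\varphi \;=\; \forall x\,\alpha \;\wedge\; \bigwedge_{1\le h\le l}\forall x\forall y\,\bigl(e_h(x,y)\rightarrow(\beta_h\vee x\approx y)\bigr)\;\wedge\;\bigwedge_{1\le i\le m}\forall x\,\exists_{=C_i}y\,\bigl(f_i(x,y)\wedge x\not\approx y\bigr),$$ where $l,m\ge 1$, $C_i\ge 1$, $e_h,f_i$ are binary predicates other than $\approx$, and $\alpha=\alpha(x)$, $\beta_h=\beta_h(x,y)$ are quantifier-free and $\approx$-free in the indicated variables. Let $C=\max_i C_i$ and let $\Sigma$ be the signature together with $\lceil\log_2((mC)^2+1)\rceil$ new unary predicates. A 1-type (2-type) is a maximal consistent set of $\approx$-free literals over $\Sigma$ in the variable $x$ (in the variables $x,y$). For a 2-type $\tau$, let $\tau^{-1}$ be the result of transposing $x$ and $y$, $\mathrm{tp}_1(\tau)$ the 1-type included in $\tau$, and $\mathrm{tp}_2(\tau)=\mathrm{tp}_1(\tau^{-1})$. A 2-type $\tau$ is a message-type if $f_i(x,y)\in\tau$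 for some $i$; a message-type $\tau$ is invertible if $\tau^{-1}$ is also a message-type, and non-invertible otherwise; $\tau$ is silent if neither $\tau$ nor $\tau^{-1}$ is a message-type. Call $\tau$ forbidden if $$\alpha(x)\wedge\alpha(y)\wedge\bigwedge_{h}\bigl(e_h(x,y)\rightarrow\beta_h(x,y)\bigr)\wedge\bigwedge_{h}\bigl(e_h(y,x)\rightarrow\beta_h(y,x)\bigr)\wedge\bigwedge\tau$$ is unsatisfiable. The number of 1-types is $2^p$ with $p=|\Sigma|$, and for each 1-type $\pi$ the number of 2-types $\tau$ with $\mathrm{tp}_1(\tau)=\pi$ and $\tau^{-1}$ not a message-type is $2^q$ with $q$ independent of $\pi$. Fix an arbitrary enumeration $\pi_0,\dots,\pi_{2^p-1}$ of the 1-types and, for each $\pi$, an enumeration $\mu_{\pi,0},\dots,\mu_{\pi,2^q-1}$ of the latter 2-types in which non-invertible message-types precede silent 2-types. For a bit-string $s$ with $|s|\le p$ let $\Pi_s$ be the block of the first enumeration obtained by passing successively to left halves (bit $0$) and right halves (bit $1$), starting from the whole enumeration $\Pi_\epsilon$. For $|t|=q$ let $\mu_{\pi,t}$ be $\mu_{\pi,j}$,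 where $j$ is the integer with binary representation $t$. Let $\Lambda_{\pi,s}$ be the set of invertible message-types $\lambda$ with $\mathrm{tp}_1(\lambda)=\pi$ and $\mathrm{tp}_2(\lambda)\in\Pi_s$. Vectors are in $\mathbb N^m$, ordered componentwise, with $\mathbf u<\mathbf v$ meaning $\mathbf u\le\mathbf v$ and $\mathbf u\ne\mathbf v$; $\mathbf C=(C_1,\dots,C_m)$; and $\mathbf C_\tau\in\{0,1\}^m$ has $i$th entry $1$ iff $f_i(x,y)\in\tau$. Consider the variables $x_\lambda$ ($\lambda$ an invertible message-type), $y_{\pi,s,\mathbf u}$ ($|s|\le p$), $z_{\pi,t,\mathbf u}$ ($|t|\le q$), $\hat y_{\pi,s,\mathbf v,\mathbf w}$ ($|s|<p$), $\hat z_{\pi,t,\mathbf v,\mathbf w}$ ($|t|<q$), with $\pi$ a 1-type, $s,t$ bit-strings, and $\mathbf u,\mathbf v,\mathbf w\le\mathbf C$. Let $\mathcal E$ consist of the following constraints (primed vectors range over vectors $\le\mathbf C$). For all $\pi$, all $|s|<p$, $|t|<q$, and $\mathbf u,\mathbf v,\mathbf w\le\mathbf C$: - $z_{\pi,\epsilon,\mathbf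 u}=y_{\pi,\epsilon,\mathbf C-\mathbf u}$; - $y_{\pi,s,\mathbf u}=\sum_{\mathbf v'+\mathbf w'=\mathbf u}\hat y_{\pi,s,\mathbf v',\mathbf w'}$ and $z_{\pi,t,\mathbf u}=\sum_{\mathbf v'+\mathbf w'=\mathbf u}\hat z_{\pi,t,\mathbf v',\mathbf w'}$; - $y_{\pi,s0,\mathbf v}=\sum_{\mathbf v+\mathbf w'\le\mathbf C}\hat y_{\pi,s,\mathbf v,\mathbf w'}$ and $y_{\pi,s1,\mathbf w}=\sum_{\mathbf v'+\mathbf w\le\mathbf C}\hat y_{\pi,s,\mathbf v',\mathbf w}$; - $z_{\pi,t0,\mathbf v}=\sum_{\mathbf v+\mathbf w'\le\mathbf C}\hat z_{\pi,t,\mathbf v,\mathbf w'}$ and $z_{\pi,t1,\mathbf w}=\sum_{\mathbf v'+\mathbf w\le\mathbf C}\hat z_{\pi,t,\mathbf v',\mathbf w}$; - $1\le\sum_{\pi'}\sum_{\mathbf u'\le\mathbf C}y_{\pi',\epsilon,\mathbf u'}$. For all $\pi,\lambda$, all $|s|=p$, $|t|=q$, and $\mathbf 0<\mathbf u\le\mathbf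 C$: - $y_{\pi,s,\mathbf u}=\sum\{x_{\lambda'}:\lambda'\in\Lambda_{\pi,s},\ \mathbf C_{\lambda'}=\mathbf u\}$; - $z_{\pi,t,\mathbf u}=0$ whenever $\mathbf u$ is not a scalar multiple of $\mathbf C_{\mu_{\pi,t}}$; - $x_{\lambda^{-1}}=x_\lambda$; - $x_\lambda=0$ whenever $\mathrm{tp}_1(\lambda)=\mathrm{tp}_2(\lambda)$; - $x_\lambda=0$ whenever $\lambda$ is forbidden; - $z_{\pi,t,\mathbf u}=0$ whenever $\mu_{\pi,t}$ is forbidden; - $z_{\pi,t,\mathbf u}>0\ \Rightarrow\ \sum_{\mathbf u'\le\mathbf C}y_{\rho,\epsilon,\mathbf u'}\ge 3mC$, where $\rho=\mathrm{tp}_2(\mu_{\pi,t})$. Then $\varphi$ has a finite (non-empty) model if and only if $\mathcal E$ has a solution over $\mathbb N$. -/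

import Mathlib

open scoped BigOperators

namespace GC2

universe u v w

/-! Two-variable first-order logic with counting quantifiers: syntax and semantics. -/

/-- The two individual variables. -/
inductive Vr
  | x
  | y
  deriving DecidableEq

instance : Fintype Vr := ⟨{Vr.x, Vr.y}, fun a => by cases a <;> simp⟩

/-- Transposition of the two variables. -/
def Vr.swap : Vr → Vr
  | Vr.x => Vr.y
  | Vr.y => Vr.x

/-- Formulas in the variables `x`, `y` with counting quantifiers, over a signature with unary
predicates `U` and binary predicates `B` (equality is a logical symbol and not a member of `B`). -/
inductive Formula (U : Type u) (B : Type v)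
  | un (p : U) (a : Vr)
  | bin (r : B) (a b : Vr)
  | eq (a b : Vr)
  | bot
  | neg (φ : Formula U B)
  | and (φ ψ : Formula U B)
  | or (φ ψ : Formula U B)
  | imp (φ ψ : Formula U B)
  | all (a : Vr) (φ : Formula U B)
  | ex (a : Vr) (φ : Formula U B)
  | exLe (n : ℕ) (a : Vr) (φ : Formula U B)
  | exGe (n : ℕ) (a : Vr) (φ : Formula U B)
  | exEq (n : ℕ) (a : Vr) (φ : Formula U B)

/-- A structure with domain `A` interpreting the signature `(U, B)`. -/
structure Struc (U : Type u) (B : Type v) (A : Type w) where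
  un : U → A → Prop
  bin : B → A → A → Prop

namespace Formula

variable {U : Type u} {B : Type v}

/-- Truth of a formula in a structure under a variable assignment. -/
def Realize {A : Type w} (S : Struc U B A) : Formula U B → (Vr → A) → Prop
  | un p a, g => S.un p (g a)
  | bin r a b, g => S.bin r (g a) (g b)
  | eq a b, g => g a = g b
  | bot, _ => False
  | neg φ, g => ¬ φ.Realize S g
  | and φ ψ, g => φ.Realize S g ∧ ψ.Realize S g
  | or φ ψ, g => φ.Realize S g ∨ ψ.Realize S g
  | imp φ ψ, g => φ.Realize S g → ψ.Realize S g
  | all a φ, g => ∀ c : A, φ.Realize S (Function.update g a c)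
  | ex a φ, g => ∃ c : A, φ.Realize S (Function.update g a c)
  | exLe n a φ, g => {c : A | φ.Realize S (Function.update g a c)}.encard ≤ n
  | exGe n a φ, g => n ≤ {c : A | φ.Realize S (Function.update g a c)}.encard
  | exEq n a φ, g => {c : A | φ.Realize S (Function.update g a c)}.encard = n

/-- The free variables of a formula. -/
def freeVars : Formula U B → Finset Vr
  | un _ a => {a}
  | bin _ a b => {a, b}
  | eq a b => {a, b}
  | bot => ∅
  | neg φ => φ.freeVars
  | and φ ψ => φ.freeVars ∪ ψ.freeVars
  | or φ ψ => φ.freeVars ∪ ψ.freeVars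
  | imp φ ψ => φ.freeVars ∪ ψ.freeVars
  | all a φ => φ.freeVars.erase a
  | ex a φ => φ.freeVars.erase a
  | exLe _ a φ => φ.freeVars.erase a
  | exGe _ a φ => φ.freeVars.erase a
  | exEq _ a φ => φ.freeVars.erase a

/-- The formula has no quantifier and no occurrence of the equality predicate. -/
def QFEqFree : Formula U B → Prop
  | un _ _ => True
  | bin _ _ _ => True
  | bot => True
  | neg φ => φ.QFEqFree
  | and φ ψ => φ.QFEqFree ∧ ψ.QFEqFree
  | or φ ψ => φ.QFEqFree ∧ ψ.QFEqFree
  | imp φ ψ => φ.QFEqFree ∧ ψ.QFEqFree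
  | eq _ _ => False
  | all _ _ => False
  | ex _ _ => False
  | exLe _ _ _ => False
  | exGe _ _ _ => False
  | exEq _ _ _ => False

/-- The conjunction of a finite list of formulas. -/
def conj : List (Formula U B) → Formula U B
  | [] => neg bot
  | φ :: L => and φ (conj L)

/-- Guard-atoms `p(x, y)` and `p(y, x)`, where `p` is a binary predicate or equality. -/
inductive IsGuard : Formula U B → Prop
  | bin (r : B) (a : Vr) : IsGuard (bin r a a.swap)
  | eq (a : Vr) : IsGuard (eq a a.swap)

/-- Membership in the two-variable guarded fragment with counting quantifiers. -/
inductive IsGC2 : Formula U B → Prop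
  | un (p : U) (a : Vr) : IsGC2 (un p a)
  | bin (r : B) (a b : Vr) : IsGC2 (bin r a b)
  | eq (a b : Vr) : IsGC2 (eq a b)
  | bot : IsGC2 bot
  | neg {φ : Formula U B} : IsGC2 φ → IsGC2 (neg φ)
  | and {φ ψ : Formula U B} : IsGC2 φ → IsGC2 ψ → IsGC2 (and φ ψ)
  | or {φ ψ : Formula U B} : IsGC2 φ → IsGC2 ψ → IsGC2 (or φ ψ)
  | imp {φ ψ : Formula U B} : IsGC2 φ → IsGC2 ψ → IsGC2 (imp φ ψ)
  | all {φ : Formula U B} (a : Vr) : IsGC2 φ → φ.freeVars.card ≤ 1 → IsGC2 (all a φ)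
  | ex {φ : Formula U B} (a : Vr) : IsGC2 φ → φ.freeVars.card ≤ 1 → IsGC2 (ex a φ)
  | guardedAll {γ φ : Formula U B} (a : Vr) : IsGuard γ → IsGC2 φ → IsGC2 (all a (imp γ φ))
  | guardedEx {γ φ : Formula U B} (a : Vr) : IsGuard γ → IsGC2 φ → IsGC2 (ex a (and γ φ))
  | guardedExLe {γ φ : Formula U B} (n : ℕ) (a : Vr) : 0 < n → IsGuard γ → IsGC2 φ →
      IsGC2 (exLe n a (and γ φ))
  | guardedExGe {γ φ : Formula U B} (n : ℕ) (a : Vr) : 0 < n → IsGuard γ → IsGC2 φ →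
      IsGC2 (exGe n a (and γ φ))
  | guardedExEq {γ φ : Formula U B} (n : ℕ) (a : Vr) : 0 < n → IsGuard γ → IsGC2 φ →
      IsGC2 (exEq n a (and γ φ))

/-- `φ` is true in some structure with a finite, non-empty domain. -/
def FinitelySatisfiable (φ : Formula U B) : Prop :=
  ∃ (A : Type) (_ : Finite A) (_ : Nonempty A) (S : Struc U B A), ∀ g : Vr → A, φ.Realize S g

end Formula

/-- The assignment `x ↦ a`, `y ↦ b`. -/
def asg {A : Type w} (a b : A) : Vr → A
  | Vr.x => a
  | Vr.y => b

/-! One-types and two-types. The equality-free atoms in the variable `x` are `p(x)` for unary `p`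
and `r(x, x)` for binary `r`; in the variables `x`, `y` they are `p(u)` and `r(u, v)` for
`u, v` among `x, y`. A maximal consistent set of equality-free literals is given by the truth
value it assigns to each atom. -/

/-- One-types: truth values for the atoms `p(x)` (`Sum.inl p`) and `r(x, x)` (`Sum.inr r`). -/
abbrev OneType (U : Type u) (B : Type v) := U ⊕ B → Bool

/-- Equality-free atoms in the variables `x` and `y`. -/
abbrev Atom (U : Type u) (B : Type v) := (U × Vr) ⊕ (B × Vr × Vr)

/-- Two-types: truth values for all the equality-free atoms in `x` and `y`. -/
abbrev TwoType (U : Type u) (B : Type v) := Atom U B → Bool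

namespace TwoType

variable {U : Type u} {B : Type v}

/-- The result `τ⁻¹` of transposing the variables in `τ`. -/
def inv (τ : TwoType U B) : TwoType U B
  | Sum.inl (p, a) => τ (Sum.inl (p, a.swap))
  | Sum.inr (r, a, b) => τ (Sum.inr (r, a.swap, b.swap))

/-- The one-type included in `τ`. -/
def tp₁ (τ : TwoType U B) : OneType U B
  | Sum.inl p => τ (Sum.inl (p, Vr.x))
  | Sum.inr r => τ (Sum.inr (r, Vr.x, Vr.x))

/-- The one-type included in `τ⁻¹`. -/
def tp₂ (τ : TwoType U B) : OneType U B := tp₁ (inv τ)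

/-- Every literal of `τ` is true in `S` when `x`, `y` are assigned `a`, `b`. -/
def Holds {A : Type w} (S : Struc U B A) (τ : TwoType U B) (a b : A) : Prop :=
  (∀ p c, τ (Sum.inl (p, c)) = true ↔ S.un p (asg a b c)) ∧
  (∀ r c d, τ (Sum.inr (r, c, d)) = true ↔ S.bin r (asg a b c) (asg a b d))

end TwoType

/-- The data of a formula in normal form
`∀x α ∧ ⋀ₕ ∀x∀y (eₕ(x,y) → (βₕ ∨ x ≈ y)) ∧ ⋀ᵢ ∀x ∃_{= Cᵢ} y (fᵢ(x,y) ∧ x ≉ y)`. -/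
structure NormalForm (U : Type u) (B : Type v) where
  α : Formula U B
  α_qf : α.QFEqFree
  α_var : α.freeVars ⊆ {Vr.x}
  l : ℕ
  l_pos : 0 < l
  e : Fin l → B
  β : Fin l → Formula U B
  β_qf : ∀ h, (β h).QFEqFree
  m : ℕ
  m_pos : 0 < m
  f : Fin m → B
  C : Fin m → ℕ
  C_pos : ∀ i, 0 < C i

namespace NormalForm

variable {U : Type u} {B : Type v}

/-- The formula with the given data. -/
def toFormula (φ : NormalForm U B) : Formula U B :=
  .and (.all Vr.x φ.α)
    (.and
      (.conj (List.ofFn fun h : Fin φ.l =>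
        .all Vr.x (.all Vr.y
          (.imp (.bin (φ.e h) Vr.x Vr.y) (.or (φ.β h) (.eq Vr.x Vr.y))))))
      (.conj (List.ofFn fun i : Fin φ.m =>
        .all Vr.x (.exEq (φ.C i) Vr.y
          (.and (.bin (φ.f i) Vr.x Vr.y) (.neg (.eq Vr.x Vr.y)))))))

theorem isGC2_toFormula (φ : NormalForm U B) : φ.toFormula.IsGC2 := by
  have hconj : ∀ L : List (Formula U B), (∀ ψ ∈ L, ψ.IsGC2) → (Formula.conj L).IsGC2 := by
    intro L
    induction L with
    | nil => exact fun _ => .neg .bot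
    | cons ψ L ih =>
      exact fun h => .and (h ψ (by simp)) (ih fun χ hχ => h χ (by simp [hχ]))
  have hqf : ∀ ψ : Formula U B, ψ.QFEqFree → ψ.IsGC2 := by
    intro ψ
    induction ψ with
    | un p a => exact fun _ => .un p a
    | bin r a b => exact fun _ => .bin r a b
    | bot => exact fun _ => .bot
    | neg ψ ih => exact fun h => .neg (ih h)
    | and ψ χ ih ih' => exact fun h => .and (ih h.1) (ih' h.2)
    | or ψ χ ih ih' => exact fun h => .or (ih h.1) (ih' h.2)
    | imp ψ χ ih ih' => exact fun h => .imp (ih h.1) (ih' h.2)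
    | _ => exact fun h => h.elim
  have hcard : ∀ s : Finset Vr, (s.erase Vr.y).card ≤ 1 := fun s =>
    Finset.card_le_one.2 fun a ha b hb => by
      cases a <;> cases b <;> simp_all
  refine .and (.all _ (hqf _ φ.α_qf) ?_) (.and (hconj _ ?_) (hconj _ ?_))
  · exact (Finset.card_le_card φ.α_var).trans (by simp)
  · intro ψ hψ
    obtain ⟨h, rfl⟩ := (List.mem_ofFn' _ _).1 hψ
    exact .all _ (.guardedAll _ (.bin _ Vr.x) (.or (hqf _ (φ.β_qf h)) (.eq _ _))) (hcard _)
  · intro ψ hψ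
    obtain ⟨i, rfl⟩ := (List.mem_ofFn' _ _).1 hψ
    exact .all _ (.guardedExEq _ _ (φ.C_pos i) (.bin _ Vr.x) (.neg (.eq _ _))) (hcard _)

/-- The number `C = max Cᵢ`. -/
def maxC (φ : NormalForm U B) : ℕ := Finset.univ.sup φ.C

/-- The number `⌈log₂ ((mC)² + 1)⌉` of additional unary predicates. -/
def numNew (φ : NormalForm U B) : ℕ := Nat.clog 2 ((φ.m * φ.maxC) ^ 2 + 1)

/-- The unary predicates of the extended signature `Σ`. -/
abbrev UExt (φ : NormalForm U B) := U ⊕ Fin φ.numNew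

/-- One-types over `Σ`. -/
abbrev OneTp (φ : NormalForm U B) := OneType φ.UExt B

/-- Two-types over `Σ`. -/
abbrev TwoTp (φ : NormalForm U B) := TwoType φ.UExt B

/-- The reduct of a structure over `Σ` to the original signature. -/
def reduct (φ : NormalForm U B) {A : Type w} (S : Struc φ.UExt B A) : Struc U B A where
  un p a := S.un (Sum.inl p) a
  bin := S.bin

/-- `τ` is a message-type: `fᵢ(x, y) ∈ τ` for some `i`. -/
abbrev IsMessage (φ : NormalForm U B) (τ : φ.TwoTp) : Prop :=
  ∃ i, τ (Sum.inr (φ.f i, Vr.x, Vr.y)) = true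

abbrev IsInvertible (φ : NormalForm U B) (τ : φ.TwoTp) : Prop :=
  φ.IsMessage τ ∧ φ.IsMessage τ.inv

abbrev IsNonInvertible (φ : NormalForm U B) (τ : φ.TwoTp) : Prop :=
  φ.IsMessage τ ∧ ¬ φ.IsMessage τ.inv

abbrev IsSilent (φ : NormalForm U B) (τ : φ.TwoTp) : Prop :=
  ¬ φ.IsMessage τ ∧ ¬ φ.IsMessage τ.inv

/-- The vector `C_τ`, whose `i`th entry is `1` if `fᵢ(x, y) ∈ τ` and `0` otherwise. -/
def msgVec (φ : NormalForm U B) (τ : φ.TwoTp) (i : Fin φ.m) : ℕ :=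
  if τ (Sum.inr (φ.f i, Vr.x, Vr.y)) = true then 1 else 0

/-- `τ` is forbidden: the formula
`α(x) ∧ α(y) ∧ ⋀ₕ (eₕ(x,y) → βₕ(x,y)) ∧ ⋀ₕ (eₕ(y,x) → βₕ(y,x)) ∧ ⋀ τ` is unsatisfiable. -/
def Forbidden (φ : NormalForm U B) (τ : φ.TwoTp) : Prop :=
  ¬ ∃ (A : Type) (S : Struc φ.UExt B A) (a b : A),
    φ.α.Realize (φ.reduct S) (asg a b) ∧ φ.α.Realize (φ.reduct S) (asg b a) ∧
    (∀ h, S.bin (φ.e h) a b → (φ.β h).Realize (φ.reduct S) (asg a b)) ∧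
    (∀ h, S.bin (φ.e h) b a → (φ.β h).Realize (φ.reduct S) (asg b a)) ∧
    τ.Holds S a b

/-- Invertible message-types. -/
abbrev InvType (φ : NormalForm U B) := {τ : φ.TwoTp // φ.IsInvertible τ}

/-- The invertible message-type `l⁻¹`. -/
def InvType.inv {φ : NormalForm U B} (l : φ.InvType) : φ.InvType :=
  ⟨TwoType.inv l.1, l.2.2, by
    have h : TwoType.inv (TwoType.inv l.1) = l.1 := by
      funext a
      rcases a with ⟨p, a⟩ | ⟨r, a, b⟩
      · cases a <;> rfl
      · cases a <;> cases b <;> rfl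
    rw [h]
    exact l.2.1⟩

/-- The two-types `τ` with `tp₁ τ = π` for which `τ⁻¹` is not a message-type. -/
abbrev MClass (φ : NormalForm U B) (π : φ.OneTp) :=
  {τ : φ.TwoTp // TwoType.tp₁ τ = π ∧ ¬ φ.IsMessage (TwoType.inv τ)}

/-- Vectors `u ≤ (C₁, …, C_m)`. -/
abbrev Vec (φ : NormalForm U B) : Type := ↥(Set.Iic φ.C)

variable [Fintype U] [DecidableEq U] [Fintype B] [DecidableEq B]

/-- The number `p = |Σ|`; there are `2 ^ p` one-types. -/
def p (φ : NormalForm U B) : ℕ := Fintype.card (φ.UExt ⊕ B)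

/-- The number `q` for which each of the classes `MClass π` has `2 ^ q` members. -/
def q (φ : NormalForm U B) : ℕ :=
  Fintype.card (φ.UExt ⊕ B) + Fintype.card B + Fintype.card {r : B // ∀ i, φ.f i ≠ r}

theorem card_oneTp (φ : NormalForm U B) : Fintype.card φ.OneTp = 2 ^ φ.p := by
  simp [NormalForm.p]

/-- A member of `MClass π` is fixed by its second one-type, the truth values of the `r(x, y)`, and
those of the `r(y, x)` for `r` not a counting predicate. -/
def mClassEquiv (φ : NormalForm U B) (π : φ.OneTp) :
    φ.MClass π ≃ φ.OneTp × (B → Bool) × ({r : B // ∀ i, φ.f i ≠ r} → Bool) where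
  toFun τ := (TwoType.tp₂ τ.1, fun r => τ.1 (Sum.inr (r, Vr.x, Vr.y)),
    fun r => τ.1 (Sum.inr (r.1, Vr.y, Vr.x)))
  invFun d := ⟨fun
      | Sum.inl (p, Vr.x) => π (Sum.inl p)
      | Sum.inl (p, Vr.y) => d.1 (Sum.inl p)
      | Sum.inr (r, Vr.x, Vr.x) => π (Sum.inr r)
      | Sum.inr (r, Vr.y, Vr.y) => d.1 (Sum.inr r)
      | Sum.inr (r, Vr.x, Vr.y) => d.2.1 r
      | Sum.inr (r, Vr.y, Vr.x) => if h : ∀ i, φ.f i ≠ r then d.2.2 ⟨r, h⟩ else false, by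
    constructor
    · funext a
      rcases a with p | r <;> rfl
    · rintro ⟨i, hi⟩
      have hn : ¬ ∀ j, φ.f j ≠ φ.f i := fun h => h i rfl
      simp [TwoType.inv, Vr.swap, hn] at hi⟩
  left_inv τ := by
    obtain ⟨τ, h1, h2⟩ := τ
    subst h1
    apply Subtype.ext
    funext a
    rcases a with ⟨p, a⟩ | ⟨r, a, b⟩
    · cases a <;> rfl
    · cases a <;> cases b <;> try rfl
      by_cases h : ∀ i, φ.f i ≠ r
      · simp [h]
      · simp only [h, dite_false]
        push Not at h
        obtain ⟨i, rfl⟩ := h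
        by_contra hc
        exact h2 ⟨i, by simpa [TwoType.inv, Vr.swap] using Ne.symm hc⟩
  right_inv d := by
    obtain ⟨d1, d2, d3⟩ := d
    refine Prod.ext ?_ (Prod.ext rfl ?_)
    · funext a
      rcases a with p | r <;> rfl
    · funext r
      simp [r.2]

theorem card_mClass (φ : NormalForm U B) (π : φ.OneTp) :
    Fintype.card (φ.MClass π) = 2 ^ φ.q := by
  rw [Fintype.card_congr (φ.mClassEquiv π)]
  simp [NormalForm.q, pow_add, mul_assoc]

/-- Enumerations `π₀, …, π_{P-1}` of the one-types and, for each one-type `π`,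
`μ_{π,0}, …, μ_{π,Q-1}` of `MClass π`, the non-invertible message-types preceding the silent
two-types. -/
structure Enumeration (φ : NormalForm U B) where
  pi : Fin (2 ^ φ.p) ≃ φ.OneTp
  mu : ∀ π : φ.OneTp, Fin (2 ^ φ.q) ≃ φ.MClass π
  mu_order : ∀ π j k, φ.IsNonInvertible (mu π j).1 → φ.IsSilent (mu π k).1 → j < k

theorem exists_sorted_equiv {X : Type w} [Fintype X] (N : X → Prop) (n : ℕ)
    (hn : Fintype.card X = n) :
    ∃ g : Fin n ≃ X, ∀ j k, N (g j) → ¬ N (g k) → j < k := by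
  classical
  have hc : Fintype.card {t // N t} + Fintype.card {t // ¬ N t} = n := by
    rw [← hn, ← Fintype.card_congr (Equiv.sumCompl N), Fintype.card_sum]
  let g := (((Fintype.equivFin {t // N t}).sumCongr
    (Fintype.equivFin {t // ¬ N t})).symm.trans (Equiv.sumCompl N))
  let e := (finSumFinEquiv (m := Fintype.card {t // N t})
    (n := Fintype.card {t // ¬ N t})).trans (finCongr hc)
  refine ⟨e.symm.trans g, ?_⟩
  intro j k
  obtain ⟨j, rfl⟩ := e.surjective j
  obtain ⟨k, rfl⟩ := e.surjective k
  simp only [Equiv.trans_apply, Equiv.symm_apply_apply]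
  intro hj hk
  rcases j with j | j
  · rcases k with k | k
    · exact absurd ((Fintype.equivFin {t // N t}).symm k).2 hk
    · simp only [e, Fin.lt_def, Equiv.trans_apply, finSumFinEquiv_apply_left,
        finSumFinEquiv_apply_right, finCongr_apply, Fin.val_cast, Fin.val_castAdd,
        Fin.val_natAdd]
      omega
  · exact absurd hj ((Fintype.equivFin {t // ¬ N t}).symm j).2

theorem nonempty_enumeration (φ : NormalForm U B) : Nonempty φ.Enumeration := by
  choose g hg using fun π : φ.OneTp => exists_sorted_equiv
    (fun τ : φ.MClass π => φ.IsMessage τ.1) (2 ^ φ.q) (φ.card_mClass π)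
  have e : Fin (2 ^ φ.p) ≃ φ.OneTp :=
    (finCongr φ.card_oneTp.symm).trans (Fintype.equivFin φ.OneTp).symm
  exact ⟨⟨e, g, fun π j k hj hk => hg π j k hj.1 hk.1⟩⟩

end NormalForm

/-- Bit strings of length at most `n`. -/
abbrev BitString (n : ℕ) := {s : List Bool // s.length ≤ n}

/-- Bit strings of length less than `n`. -/
abbrev ShortString (n : ℕ) := {s : List Bool // s.length < n}

namespace ShortString

variable {n : ℕ}

/-- The string `s` itself. -/
def str (s : ShortString n) : BitString n := ⟨s.1, s.2.le⟩

/-- The string `s0` (for `b = false`) or `s1` (for `b = true`). -/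
def ext (s : ShortString n) (b : Bool) : BitString n :=
  ⟨s.1 ++ [b], by have h := s.2; simp; omega⟩

end ShortString

/-- The empty string. -/
def eps (n : ℕ) : BitString n := ⟨[], Nat.zero_le n⟩

/-- The index interval `j, …, k - 1` obtained from `0, …, N - 1` by passing, for each successive bit
of the string, to the left half (bit `false`, i.e. 0) or the right half (bit `true`, i.e. 1);
`segFrom (j, k) s = (j', k')` starts from the interval `j, …, k - 1`. -/
def segFrom : ℕ × ℕ → List Bool → ℕ × ℕ
  | jk, [] => jk
  | (j, k), false :: s => segFrom (j, (j + k) / 2) s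
  | (j, k), true :: s => segFrom ((j + k) / 2, k) s

/-- The integer `i < 2 ^ n` is in the interval determined by the bit string `s`. -/
def InSeg {n : ℕ} (s : BitString n) (i : Fin (2 ^ n)) : Prop :=
  (segFrom (0, 2 ^ n) s.1).1 ≤ i.1 ∧ i.1 < (segFrom (0, 2 ^ n) s.1).2

namespace NormalForm

variable {U : Type u} {B : Type v} [Fintype U] [DecidableEq U] [Fintype B] [DecidableEq B]

/-- The variables of the constraint system. -/
inductive Var (φ : NormalForm U B)
  | x (l : φ.InvType)
  | y (π : φ.OneTp) (s : BitString φ.p) (u : φ.Vec)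
  | z (π : φ.OneTp) (t : BitString φ.q) (u : φ.Vec)
  | yHat (π : φ.OneTp) (s : ShortString φ.p) (v w : φ.Vec)
  | zHat (π : φ.OneTp) (t : ShortString φ.q) (v w : φ.Vec)

/-- The vector `C - u`. -/
def Vec.compl {φ : NormalForm U B} (u : φ.Vec) : φ.Vec :=
  ⟨fun i => φ.C i - u.1 i, fun i => Nat.sub_le (φ.C i) (u.1 i)⟩

/-- `l ∈ Λ_{π,s}`: `tp₁ l = π` and `tp₂ l ∈ Π_s`. -/
def Enumeration.InLambda {φ : NormalForm U B} (E : φ.Enumeration) (π : φ.OneTp)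
    (s : BitString φ.p) (l : φ.InvType) : Prop :=
  TwoType.tp₁ l.1 = π ∧ InSeg s (E.pi.symm (TwoType.tp₂ l.1))

/-- `τ` is a member of `M_{π,t}`; when `|t| = q`, this says that `τ` is `μ_{π,t}`. -/
def Enumeration.InM {φ : NormalForm U B} (E : φ.Enumeration) (π : φ.OneTp)
    (t : BitString φ.q) (τ : φ.TwoTp) : Prop :=
  ∃ j, InSeg t j ∧ (E.mu π j).1 = τ

open scoped Classical in
/-- The assignment `θ` of natural numbers to the variables satisfies all the constraints. -/
structure IsSolution (φ : NormalForm U B) (E : φ.Enumeration) (θ : φ.Var → ℕ) : Prop where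
  z_eps : ∀ π u, θ (.z π (eps φ.q) u) = θ (.y π (eps φ.p) (Vec.compl u))
  y_split : ∀ π (s : ShortString φ.p) (u : φ.Vec), θ (.y π s.str u) =
    ∑ d : φ.Vec × φ.Vec with d.1.1 + d.2.1 = u.1, θ (.yHat π s d.1 d.2)
  z_split : ∀ π (t : ShortString φ.q) (u : φ.Vec), θ (.z π t.str u) =
    ∑ d : φ.Vec × φ.Vec with d.1.1 + d.2.1 = u.1, θ (.zHat π t d.1 d.2)
  y_left : ∀ π (s : ShortString φ.p) (v : φ.Vec), θ (.y π (s.ext false) v) =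
    ∑ w : φ.Vec with v.1 + w.1 ≤ φ.C, θ (.yHat π s v w)
  y_right : ∀ π (s : ShortString φ.p) (w : φ.Vec), θ (.y π (s.ext true) w) =
    ∑ v : φ.Vec with v.1 + w.1 ≤ φ.C, θ (.yHat π s v w)
  z_left : ∀ π (t : ShortString φ.q) (v : φ.Vec), θ (.z π (t.ext false) v) =
    ∑ w : φ.Vec with v.1 + w.1 ≤ φ.C, θ (.zHat π t v w)
  z_right : ∀ π (t : ShortString φ.q) (w : φ.Vec), θ (.z π (t.ext true) w) =
    ∑ v : φ.Vec with v.1 + w.1 ≤ φ.C, θ (.zHat π t v w)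
  nonempty : 1 ≤ ∑ π : φ.OneTp, ∑ u : φ.Vec, θ (.y π (eps φ.p) u)
  y_leaf : ∀ π (s : BitString φ.p) (u : φ.Vec), s.1.length = φ.p → 0 < u.1 →
    θ (.y π s u) = ∑ l : φ.InvType with E.InLambda π s l ∧ φ.msgVec l.1 = u.1, θ (.x l)
  z_leaf : ∀ π (t : BitString φ.q) (u : φ.Vec) τ, t.1.length = φ.q → 0 < u.1 →
    E.InM π t τ → (¬ ∃ n : ℕ, u.1 = n • φ.msgVec τ) → θ (.z π t u) = 0
  x_inv : ∀ l : φ.InvType, θ (.x l.inv) = θ (.x l)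
  x_chromatic : ∀ l : φ.InvType, TwoType.tp₁ l.1 = TwoType.tp₂ l.1 → θ (.x l) = 0
  x_forbidden : ∀ l : φ.InvType, φ.Forbidden l.1 → θ (.x l) = 0
  z_forbidden : ∀ π (t : BitString φ.q) (u : φ.Vec) τ, t.1.length = φ.q → 0 < u.1 →
    E.InM π t τ → φ.Forbidden τ → θ (.z π t u) = 0
  z_large : ∀ π (t : BitString φ.q) (u : φ.Vec) τ, t.1.length = φ.q → 0 < u.1 →
    E.InM π t τ → 0 < θ (.z π t u) →
    3 * φ.m * φ.maxC ≤ ∑ w : φ.Vec, θ (.y (TwoType.tp₂ τ) (eps φ.p) w)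

end NormalForm

end GC2

/-! A solution of the constraints is a census of a sufficiently regular finite model, and such a
census contains enough information to rebuild a model.

From models to solutions: a finite model is first made rich (`exists_rich_model`). Taking $3mC$
disjoint copies makes every one-type that occurs occur at least $3mC$ times; this is harmless
because every binary condition is guarded. The graph of invertible messages has degree at most
$\sum_i C_i\le mC$, so $(mC)^2+1$ colours, coded in binary by the new unary predicates, separate
elements at distance at most two. Hence an element sends at most one invertible message to each
one-type, and none to its own. The variables then count elements by the messages they send, added up
over dyadic blocks of types, and the hatted variables count them by the two halves of a block
jointly. The branching equations are double counting (`treeCounts_of_leaves`), and the leaf equation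
for $x_\lambda$ is the uniqueness of invertible messages (`Typing.IsRich.count_leaf`).

From solutions to models: the $y_{\pi,\epsilon,\mathbf u}$ prescribe how many elements have one-type
$\pi$ and send invertible messages of total $\mathbf u$. The hatted variables say how to split these
vectors down the tree until each leaf carries a vector (`TreeCounts.exists_leaves`). A nonzero leaf
of the $y$-tree becomes one invertible message-type, and $x_\lambda=x_{\lambda^{-1}}$ allows the
senders of $\lambda$ and of $\lambda^{-1}$ to be paired off (`IsSolution.exists_links`). The
$z$-tree splits the remaining $\mathbf C-\mathbf u$ into multiples of $\mathbf C_{\mu_{\pi,t}}$,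
that is, numbers of non-invertible messages (`IsSolution.exists_multiplicities`). Their receivers
are found by cutting each large one-type into three classes and always sending to the cyclically
next class: no two elements then choose each other, and $mC$ candidates per class suffice to keep
receivers distinct. Pairs without messages get a type with no binary atoms between the two elements,
which satisfies every guarded condition vacuously. -/

namespace GC2

/-! ### Fibre counting. -/

open scoped Classical in
theorem card_subtype_eq_sum_fiber {X Λ : Type*} [Finite X] (P : X → Prop) (g : X → Λ)
    (K : Finset Λ) (h : ∀ a, P a → g a ∈ K) :
    Nat.card {a // P a} = ∑ k ∈ K, Nat.card {a // P a ∧ g a = k} := by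
  have := Fintype.ofFinite X
  simp only [Nat.card_eq_fintype_card, Fintype.card_subtype]
  rw [Finset.card_eq_sum_card_fiberwise (f := g) (t := K) (fun a ha => h a (by simpa using ha))]
  simp only [Finset.filter_filter]

/-- A function whose fibres have the sizes of the fibres of the projection from the multiset
`x` of indices lifts to a function with fibre sizes given by `x`. -/
theorem exists_lift_of_card_fiber {X V Λ : Type*} [Finite X] [Fintype Λ] [DecidableEq V]
    (c : Λ → V) (g : X → V) (x : Λ → ℕ)
    (h : ∀ v, Nat.card {a // g a = v} = ∑ l with c l = v, x l) :
    ∃ L : X → Λ, (∀ a, c (L a) = g a) ∧ ∀ l, Nat.card {a // L a = l} = x l := by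
  -- The fibre over `v` has as many elements as there are labelled copies of the indices above `v`.
  -- Gluing these bijections identifies `X` with all labelled copies, and forgetting the label is
  -- the lift.
  have e : ∀ v, {a // g a = v} ≃ Σ l : {l // c l = v}, Fin (x l.1) := by
    intro v
    refine (Finite.card_eq.1 ?_).some
    rw [h v, Nat.card_sigma]
    simp only [Nat.card_eq_fintype_card, Fintype.card_fin]
    exact Finset.sum_subtype _ (by simp) _
  let e' : (Σ v, Σ l : {l // c l = v}, Fin (x l.1)) ≃ Σ l, Fin (x l) :=
    { toFun := fun q => ⟨q.2.1.1, q.2.2⟩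
      invFun := fun q => ⟨c q.1, ⟨q.1, rfl⟩, q.2⟩
      left_inv := by rintro ⟨_, ⟨l, rfl⟩, i⟩; rfl
      right_inv := fun _ => rfl }
  let E : X ≃ Σ l, Fin (x l) :=
    ((Equiv.sigmaFiberEquiv g).symm.trans (Equiv.sigmaCongrRight e)).trans e'
  refine ⟨fun a => (E a).1, fun a => (e (g a) ⟨a, rfl⟩).1.2, fun l => ?_⟩
  rw [Nat.card_congr ((E.subtypeEquiv (q := fun q => q.1 = l) fun a => Iff.rfl).trans
    (Equiv.sigmaSubtype l)), Nat.card_eq_fintype_card, Fintype.card_fin]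

/-! ### Dyadic segments indexed by bit strings. -/

theorem segFrom_append (jk : ℕ × ℕ) (s t : List Bool) :
    segFrom jk (s ++ t) = segFrom (segFrom jk s) t := by
  induction s generalizing jk with
  | nil => rfl
  | cons b s ih => cases b <;> exact ih _

/-- Widths remain powers of two, so each division by two is exact. -/
theorem segFrom_width (s : List Bool) (k a : ℕ) :
    ∃ a', segFrom (a, a + 2 ^ (k + s.length)) s = (a', a' + 2 ^ k) := by
  induction s generalizing a with
  | nil => exact ⟨a, rfl⟩
  | cons b s ih =>
    have h : (a + (a + 2 ^ (k + (b :: s).length))) / 2 = a + 2 ^ (k + s.length) := by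
      rw [List.length_cons, ← add_assoc, ← add_assoc, pow_succ]
      omega
    have h' : a + 2 ^ (k + (b :: s).length) =
        a + 2 ^ (k + s.length) + 2 ^ (k + s.length) := by
      rw [List.length_cons, ← add_assoc, pow_succ]
      omega
    cases b
    · simp only [segFrom, h]
      exact ih a
    · simp only [segFrom, h]
      rw [h']
      exact ih _

theorem segFrom_bitString {n : ℕ} (s : List Bool) (hs : s.length ≤ n) :
    ∃ a, segFrom (0, 2 ^ n) s = (a, a + 2 ^ (n - s.length)) := by
  have := segFrom_width s (n - s.length) 0
  rwa [Nat.sub_add_cancel hs, zero_add] at this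

theorem inSeg_eps {n : ℕ} (j : Fin (2 ^ n)) : InSeg (eps n) j :=
  ⟨Nat.zero_le _, j.2⟩

theorem inSeg_str_iff {n : ℕ} (s : ShortString n) (j : Fin (2 ^ n)) :
    InSeg s.str j ↔ InSeg (s.ext false) j ∨ InSeg (s.ext true) j := by
  obtain ⟨a, ha⟩ := segFrom_bitString s.1 s.2.le
  simp only [InSeg, ShortString.ext, ShortString.str, segFrom_append, ha, segFrom]
  omega

theorem not_inSeg_ext_false_true {n : ℕ} (s : ShortString n) (j : Fin (2 ^ n)) :
    ¬ (InSeg (s.ext false) j ∧ InSeg (s.ext true) j) := by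
  simp only [InSeg, ShortString.ext, segFrom_append, segFrom]
  omega

theorem exists_inSeg_iff_eq {n : ℕ} (s : BitString n) (hs : s.1.length = n) :
    ∃ j₀ : Fin (2 ^ n), ∀ j, InSeg s j ↔ j = j₀ := by
  obtain ⟨a, ha⟩ := segFrom_bitString s.1 s.2
  -- The right end never moves up, so the one surviving index is below `2 ^ n`.
  have hlt : ∀ (t : List Bool) (j k : ℕ), j ≤ k → (segFrom (j, k) t).2 ≤ k := by
    intro t
    induction t with
    | nil => intros; exact le_rfl
    | cons b t ih =>
      intro j k hjk
      cases b
      · exact (ih _ _ (by omega)).trans (by omega)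
      · exact ih _ _ (by omega)
  have h := hlt s.1 0 (2 ^ n) (Nat.zero_le _)
  simp only [ha, hs, Nat.sub_self, pow_zero] at h
  refine ⟨⟨a, h⟩, fun j => ?_⟩
  simp only [InSeg, ha, hs, Nat.sub_self, pow_zero, Fin.ext_iff]
  omega

theorem existsUnique_inSeg {n : ℕ} (j : Fin (2 ^ n)) (k : ℕ) (hk : k ≤ n) :
    ∃! s : BitString n, s.1.length = k ∧ InSeg s j := by
  induction k with
  | zero =>
    refine ⟨eps n, ⟨rfl, inSeg_eps j⟩, ?_⟩
    rintro ⟨s, hs⟩ ⟨h, -⟩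
    exact Subtype.ext (List.length_eq_zero_iff.1 h)
  | succ k ih =>
    obtain ⟨s, ⟨hs, hj⟩, hu⟩ := ih (by omega)
    let s' : ShortString n := ⟨s.1, by omega⟩
    -- Dropping the last bit of `t` gives a string of length `k` whose segment still contains `j`,
    -- which is `s` by uniqueness.
    have key : ∀ t : BitString n, t.1.length = k + 1 → InSeg t j → ∃ b, t = s'.ext b := by
      rintro ⟨t, ht⟩ hk1 htj
      have hne : t ≠ [] := by rintro rfl; simp at hk1
      have hd := List.dropLast_append_getLast hne
      let r : ShortString n := ⟨t.dropLast, by simp; simp at hk1; omega⟩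
      have hr : (⟨t, ht⟩ : BitString n) = r.ext (t.getLast hne) := Subtype.ext hd.symm
      have hrj : InSeg r.str j := by
        rw [inSeg_str_iff]
        rw [hr] at htj
        cases h : t.getLast hne <;> rw [h] at htj
        · exact Or.inl htj
        · exact Or.inr htj
      have hrs : r.str = s := hu _ ⟨by simp [r, ShortString.str]; simp at hk1; omega, hrj⟩
      refine ⟨t.getLast hne, ?_⟩
      rw [hr]
      apply Subtype.ext
      simp only [ShortString.ext, s', ← hrs, ShortString.str]
    have hl : ∀ b, (s'.ext b).1.length = k + 1 := fun b => by simp [ShortString.ext, s', hs]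
    have hn := not_inSeg_ext_false_true s' j
    rcases (inSeg_str_iff s' j).1 hj with h | h
    · refine ⟨s'.ext false, ⟨hl _, h⟩, ?_⟩
      rintro t ⟨ht, htj⟩
      obtain ⟨b, rfl⟩ := key t ht htj
      cases b
      · rfl
      · exact absurd ⟨h, htj⟩ hn
    · refine ⟨s'.ext true, ⟨hl _, h⟩, ?_⟩
      rintro t ⟨ht, htj⟩
      obtain ⟨b, rfl⟩ := key t ht htj
      cases b
      · exact absurd ⟨htj, h⟩ hn
      · rfl

open scoped Classical in
theorem sum_inSeg_str {n : ℕ} {M : Type*} [AddCommMonoid M] (s : ShortString n)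
    (w : Fin (2 ^ n) → M) :
    ∑ j with InSeg s.str j, w j =
      ∑ j with InSeg (s.ext false) j, w j + ∑ j with InSeg (s.ext true) j, w j := by
  rw [← Finset.sum_union]
  · congr 1
    ext j
    simp [inSeg_str_iff]
  · rw [Finset.disjoint_filter]
    exact fun j _ h h' => not_inSeg_ext_false_true s j ⟨h, h'⟩

/-! ### Vectors distributed over a binary tree. -/

open scoped Classical in
/-- Vectors at the nodes of the binary tree, bounded by `C` and additive at each branching, as
counted by `Y` and, at the inner nodes, jointly at the two children, by `Yh`. -/
structure TreeCounts {ι : Type*} [Fintype ι] (C : ι → ℕ) (n : ℕ)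
    (Y : BitString n → ↥(Set.Iic C) → ℕ)
    (Yh : ShortString n → ↥(Set.Iic C) → ↥(Set.Iic C) → ℕ) : Prop where
  split : ∀ (s : ShortString n) (u : ↥(Set.Iic C)), Y s.str u =
    ∑ d : ↥(Set.Iic C) × ↥(Set.Iic C) with d.1.1 + d.2.1 = u.1, Yh s d.1 d.2
  left : ∀ (s : ShortString n) (v : ↥(Set.Iic C)), Y (s.ext false) v =
    ∑ w : ↥(Set.Iic C) with v.1 + w.1 ≤ C, Yh s v w
  right : ∀ (s : ShortString n) (w : ↥(Set.Iic C)), Y (s.ext true) w =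
    ∑ v : ↥(Set.Iic C) with v.1 + w.1 ≤ C, Yh s v w

-- Double counting: the elements are sorted by their pair of child sums. The bound `hw` keeps the
-- sum of such a pair below `C`, so the restrictions on the index sets lose no element.
open scoped Classical in
theorem treeCounts_of_leaves {ι X : Type*} [Fintype ι] [Finite X] {C : ι → ℕ} {n : ℕ}
    (w : Fin (2 ^ n) → X → ι → ℕ) (hw : ∀ a, ∑ j, w j a ≤ C) :
    TreeCounts C n (fun s u => Nat.card {a // ∑ j with InSeg s j, w j a = u.1})
      (fun s v v' => Nat.card {a // ∑ j with InSeg (s.ext false) j, w j a = v.1 ∧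
        ∑ j with InSeg (s.ext true) j, w j a = v'.1}) := by
  have hle : ∀ (s : BitString n) a, ∑ j with InSeg s j, w j a ≤ C := fun s a =>
    (Finset.sum_le_sum_of_subset (Finset.filter_subset _ _)).trans (hw a)
  let F : BitString n → X → ↥(Set.Iic C) := fun s a => ⟨_, hle s a⟩
  have hF : ∀ (s : ShortString n) a, (F (s.ext false) a).1 + (F (s.ext true) a).1 ≤ C := by
    intro s a
    have := hle s.str a
    rwa [sum_inSeg_str] at this
  refine ⟨fun s u => ?_, fun s v => ?_, fun s v => ?_⟩
  · rw [card_subtype_eq_sum_fiber _ (fun a => (F (s.ext false) a, F (s.ext true) a))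
      (Finset.univ.filter fun d => d.1.1 + d.2.1 = u.1)]
    · refine Finset.sum_congr rfl fun d hd => ?_
      congr 2
      ext a
      simp only [Finset.mem_filter, Finset.mem_univ, true_and] at hd
      simp only [Prod.ext_iff, Subtype.ext_iff, F, sum_inSeg_str]
      refine ⟨fun h => h.2, fun h => ⟨?_, h⟩⟩
      rw [h.1, h.2, hd]
    · intro a ha
      rw [sum_inSeg_str] at ha
      simpa [F] using ha
  · rw [card_subtype_eq_sum_fiber _ (F (s.ext true))
      (Finset.univ.filter fun d => v.1 + d.1 ≤ C)]
    · refine Finset.sum_congr rfl fun d hd => ?_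
      congr 2
      ext a
      simp only [Subtype.ext_iff, F]
    · intro a ha
      rw [← ha]
      simpa using hF s a
  · rw [card_subtype_eq_sum_fiber _ (F (s.ext false))
      (Finset.univ.filter fun d => d.1 + v.1 ≤ C)]
    · refine Finset.sum_congr rfl fun d hd => ?_
      congr 2
      ext a
      simp only [Subtype.ext_iff, F]
      exact and_comm
    · intro a ha
      rw [← ha]
      simpa using hF s a

namespace TreeCounts

variable {ι X : Type*} [Fintype ι] [Finite X] {C : ι → ℕ} {n : ℕ}
  {Y : BitString n → ↥(Set.Iic C) → ℕ}
  {Yh : ShortString n → ↥(Set.Iic C) → ↥(Set.Iic C) → ℕ}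

-- The converse of double counting at one node: the elements are dealt out to the pairs of child
-- vectors in the numbers given by `Yh`. Only pairs with sum at most `C` serve as indices, as in the
-- `left` and `right` identities.
open scoped Classical in
theorem exists_branch (hY : TreeCounts C n Y Yh) (s : ShortString n) (f : X → ↥(Set.Iic C))
    (hf : ∀ u, Nat.card {a // f a = u} = Y s.str u) :
    ∃ f₀ f₁ : X → ↥(Set.Iic C), (∀ a, (f a).1 = (f₀ a).1 + (f₁ a).1) ∧
      (∀ u, Nat.card {a // f₀ a = u} = Y (s.ext false) u) ∧
      ∀ u, Nat.card {a // f₁ a = u} = Y (s.ext true) u := by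
  obtain ⟨L, hL, hx⟩ := exists_lift_of_card_fiber
    (Λ := {d : ↥(Set.Iic C) × ↥(Set.Iic C) // d.1.1 + d.2.1 ≤ C})
    (fun d => (⟨d.1.1.1 + d.1.2.1, d.2⟩ : ↥(Set.Iic C))) f (fun d => Yh s d.1.1 d.1.2) (by
      intro u
      rw [hf, hY.split]
      symm
      refine Finset.sum_bij (fun d _ => d.1) ?_ ?_ ?_ ?_
      · rintro d hd
        simpa [Subtype.ext_iff] using hd
      · exact fun d _ d' _ h => Subtype.ext h
      · intro d hd
        simp only [Finset.mem_filter, Finset.mem_univ, true_and] at hd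
        exact ⟨⟨d, hd.le.trans u.2⟩, by simpa [Subtype.ext_iff] using hd, rfl⟩
      · exact fun _ _ => rfl)
  refine ⟨fun a => (L a).1.1, fun a => (L a).1.2, fun a => ?_, fun v => ?_, fun v => ?_⟩
  · rw [← hL a]
  · rw [card_subtype_eq_sum_fiber _ L (Finset.univ.filter fun d => d.1.1 = v)
      (by simp), hY.left]
    refine Finset.sum_bij (fun d _ => d.1.2) ?_ ?_ ?_ ?_
    · rintro ⟨d, hd⟩ h
      simp only [Finset.mem_filter, Finset.mem_univ, true_and] at h ⊢
      rwa [← h]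
    · rintro ⟨⟨d, d'⟩, hd⟩ h ⟨⟨r, r'⟩, hr⟩ h' heq
      simp only [Finset.mem_filter, Finset.mem_univ, true_and] at h h' heq
      subst h h' heq
      rfl
    · intro w hw
      simp only [Finset.mem_filter, Finset.mem_univ, true_and] at hw
      exact ⟨⟨(v, w), hw⟩, by simp, rfl⟩
    · rintro d hd
      simp only [Finset.mem_filter, Finset.mem_univ, true_and] at hd
      rw [← hd, ← hx d]
      congr 2
      ext a
      exact ⟨fun h => h.2, fun h => ⟨by simp only [h], h⟩⟩
  · rw [card_subtype_eq_sum_fiber _ L (Finset.univ.filter fun d => d.1.2 = v)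
      (by simp), hY.right]
    refine Finset.sum_bij (fun d _ => d.1.1) ?_ ?_ ?_ ?_
    · rintro ⟨d, hd⟩ h
      simp only [Finset.mem_filter, Finset.mem_univ, true_and] at h ⊢
      rwa [← h]
    · rintro ⟨⟨d, d'⟩, hd⟩ h ⟨⟨r, r'⟩, hr⟩ h' heq
      simp only [Finset.mem_filter, Finset.mem_univ, true_and] at h h' heq
      subst h h' heq
      rfl
    · intro w hw
      simp only [Finset.mem_filter, Finset.mem_univ, true_and] at hw
      exact ⟨⟨(w, v), hw⟩, by simp, rfl⟩
    · rintro d hd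
      simp only [Finset.mem_filter, Finset.mem_univ, true_and] at hd
      rw [← hd, ← hx d]
      congr 2
      ext a
      exact ⟨fun h => h.2, fun h => ⟨by simp only [h], h⟩⟩

-- Induction on the height `k` of the node, with one `exists_branch` per level.
open scoped Classical in
theorem exists_leaves_below (hY : TreeCounts C n Y Yh) (k : ℕ) :
    ∀ (s : BitString n), s.1.length + k = n → ∀ f : X → ↥(Set.Iic C),
    (∀ u, Nat.card {a // f a = u} = Y s u) →
    ∃ w : Fin (2 ^ n) → X → ↥(Set.Iic C), (∀ a, ∑ j with InSeg s j, (w j a).1 = (f a).1) ∧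
      ∀ t : BitString n, t.1.length = n → ∀ j, InSeg s j → InSeg t j →
        ∀ u, Nat.card {a // w j a = u} = Y t u := by
  induction k with
  | zero =>
    intro s hs f hf
    obtain ⟨j₀, hj₀⟩ := exists_inSeg_iff_eq s hs
    refine ⟨fun _ => f, fun a => ?_, fun t ht j hj hj' u => ?_⟩
    · simp [hj₀, Finset.filter_eq']
    · rw [(existsUnique_inSeg j n le_rfl).unique ⟨ht, hj'⟩ ⟨hs, hj⟩, hf]
  | succ k ih =>
    intro s hs f hf
    let r : ShortString n := ⟨s.1, by omega⟩
    obtain ⟨f₀, f₁, hadd, h₀, h₁⟩ := hY.exists_branch r f hf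
    have hl : ∀ b, (r.ext b).1.length + k = n := fun b => by
      simp [ShortString.ext, r]; omega
    obtain ⟨w₀, hw₀, hc₀⟩ := ih (r.ext false) (hl _) f₀ h₀
    obtain ⟨w₁, hw₁, hc₁⟩ := ih (r.ext true) (hl _) f₁ h₁
    -- The values at indices outside the segment of `s` are junk; only those inside it are summed or
    -- counted.
    refine ⟨fun j => if InSeg (r.ext false) j then w₀ j else w₁ j, fun a => ?_, ?_⟩
    · change ∑ j with InSeg r.str j, _ = _
      rw [sum_inSeg_str, hadd, ← hw₀, ← hw₁]
      congr 1
      · refine Finset.sum_congr rfl fun j hj => ?_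
        simp only [if_pos (Finset.mem_filter.1 hj).2]
      · refine Finset.sum_congr rfl fun j hj => ?_
        have h : ¬ InSeg (r.ext false) j := fun h =>
          not_inSeg_ext_false_true r j ⟨h, (Finset.mem_filter.1 hj).2⟩
        simp only [if_neg h]
    · intro t ht j hj hj' u
      by_cases h : InSeg (r.ext false) j
      · simp only [if_pos h]
        exact hc₀ t ht j h hj' u
      · simp only [if_neg h]
        exact hc₁ t ht j (((inSeg_str_iff r j).1 hj).resolve_left h) hj' u

theorem exists_leaves (hY : TreeCounts C n Y Yh) (f : X → ↥(Set.Iic C))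
    (hf : ∀ u, Nat.card {a // f a = u} = Y (eps n) u) :
    ∃ w : Fin (2 ^ n) → X → ↥(Set.Iic C), (∀ a, ∑ j, (w j a).1 = (f a).1) ∧
      ∀ t : BitString n, t.1.length = n → ∀ j, InSeg t j →
        ∀ u, Nat.card {a // w j a = u} = Y t u := by
  obtain ⟨w, hw, hc⟩ := hY.exists_leaves_below n (eps n) (by simp [eps]) f hf
  exact ⟨w, fun a => by simpa [inSeg_eps] using hw a, fun t ht j => hc t ht j (inSeg_eps j)⟩

end TreeCounts

-- Structures as typings by one-types and two-types.

universe u v w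

variable {U : Type u} {B : Type v}

/-- Freedom from equality is essential: the two variables may be given equal elements on one side
and distinct ones on the other, as can happen with the witness of a non-forbidden type. -/
theorem Formula.realize_congr {A : Type w} {A' : Type*} (S : Struc U B A) (S' : Struc U B A')
    (g : Vr → A) (g' : Vr → A') (ψ : Formula U B) (hψ : ψ.QFEqFree)
    (hun : ∀ p, ∀ a ∈ ψ.freeVars, S.un p (g a) ↔ S'.un p (g' a))
    (hbin : ∀ r, ∀ a ∈ ψ.freeVars, ∀ b ∈ ψ.freeVars,
      S.bin r (g a) (g b) ↔ S'.bin r (g' a) (g' b)) :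
    ψ.Realize S g ↔ ψ.Realize S' g' := by
  induction ψ with
  | un p a => exact hun p a (by simp [freeVars])
  | bin r a b => exact hbin r a (by simp [freeVars]) b (by simp [freeVars])
  | bot => exact Iff.rfl
  | neg ψ ih => exact not_congr (ih hψ hun hbin)
  | and ψ χ ih ih' =>
    simp only [freeVars, Finset.mem_union] at hun hbin
    exact and_congr
      (ih hψ.1 (fun p a ha => hun p a (.inl ha))
        fun r a ha b hb => hbin r a (.inl ha) b (.inl hb))
      (ih' hψ.2 (fun p a ha => hun p a (.inr ha))
        fun r a ha b hb => hbin r a (.inr ha) b (.inr hb))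
  | or ψ χ ih ih' =>
    simp only [freeVars, Finset.mem_union] at hun hbin
    exact or_congr
      (ih hψ.1 (fun p a ha => hun p a (.inl ha))
        fun r a ha b hb => hbin r a (.inl ha) b (.inl hb))
      (ih' hψ.2 (fun p a ha => hun p a (.inr ha))
        fun r a ha b hb => hbin r a (.inr ha) b (.inr hb))
  | imp ψ χ ih ih' =>
    simp only [freeVars, Finset.mem_union] at hun hbin
    exact imp_congr
      (ih hψ.1 (fun p a ha => hun p a (.inl ha))
        fun r a ha b hb => hbin r a (.inl ha) b (.inl hb))
      (ih' hψ.2 (fun p a ha => hun p a (.inr ha))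
        fun r a ha b hb => hbin r a (.inr ha) b (.inr hb))
  | _ => exact hψ.elim

theorem Formula.realize_conj {A : Type w} (S : Struc U B A) (g : Vr → A)
    (L : List (Formula U B)) : (Formula.conj L).Realize S g ↔ ∀ ψ ∈ L, ψ.Realize S g := by
  induction L with
  | nil => simp [conj, Realize]
  | cons ψ L ih => simp [conj, Realize, ih]

theorem TwoType.inv_inv (τ : TwoType U B) : τ.inv.inv = τ := by
  funext a
  rcases a with ⟨p, a⟩ | ⟨r, a, b⟩
  · cases a <;> rfl
  · cases a <;> cases b <;> rfl

theorem TwoType.tp₂_inv (τ : TwoType U B) : τ.inv.tp₂ = τ.tp₁ := by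
  rw [tp₂, inv_inv]

theorem update_y_asg {A : Type w} (a b c : A) :
    Function.update (asg a c) Vr.y b = asg a b := by
  funext c
  cases c <;> simp [asg, Function.update]

theorem update_x_asg {A : Type w} (g : Vr → A) (a : A) :
    Function.update g Vr.x a = asg a (g Vr.y) := by
  funext c
  cases c <;> simp [asg, Function.update]

namespace NormalForm

variable (φ : NormalForm U B)

theorem realize_toFormula_iff {A : Type w} (S : Struc U B A) (g : Vr → A) :
    φ.toFormula.Realize S g ↔ (∀ a, φ.α.Realize S (asg a (g Vr.y))) ∧
      (∀ h a b, a ≠ b → S.bin (φ.e h) a b → (φ.β h).Realize S (asg a b)) ∧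
      ∀ i a, {b | S.bin (φ.f i) a b ∧ a ≠ b}.encard = φ.C i := by
  simp only [toFormula, Formula.Realize, Formula.realize_conj, List.forall_mem_ofFn_iff,
    update_y_asg, update_x_asg]
  refine and_congr Iff.rfl (and_congr ?_ Iff.rfl)
  refine forall_congr' fun h => forall_congr' fun a => forall_congr' fun b => ?_
  simp only [asg]
  tauto

theorem realize_α_congr {A : Type w} {A' : Type*} (S : Struc U B A) (S' : Struc U B A')
    (a b : A) (a' b' : A') (hun : ∀ p, S.un p a ↔ S'.un p a')
    (hbin : ∀ r, S.bin r a a ↔ S'.bin r a' a') :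
    φ.α.Realize S (asg a b) ↔ φ.α.Realize S' (asg a' b') := by
  refine Formula.realize_congr _ _ _ _ _ φ.α_qf ?_ ?_
  · intro p c hc
    obtain rfl := Finset.mem_singleton.1 (φ.α_var hc)
    exact hun p
  · intro r c hc d hd
    obtain rfl := Finset.mem_singleton.1 (φ.α_var hc)
    obtain rfl := Finset.mem_singleton.1 (φ.α_var hd)
    exact hbin r

/-- A one-type for each element and a two-type for each pair of distinct elements of `A`,
compatible with each other. -/
structure Typing (A : Type w) where
  tp : A → φ.OneTp
  T : A → A → φ.TwoTp
  T_inv : ∀ a b, a ≠ b → T b a = (T a b).inv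
  tp₁_T : ∀ a b, a ≠ b → (T a b).tp₁ = tp a

variable {φ}

theorem Typing.tp₂_T {A : Type w} (M : φ.Typing A) {a b : A} (h : a ≠ b) :
    (M.T a b).tp₂ = M.tp b := by
  rw [TwoType.tp₂, ← M.T_inv a b h, M.tp₁_T b a h.symm]

open scoped Classical in
/-- No forbidden two-type occurs, and each element sends the right numbers of messages. -/
structure Typing.IsModel {A : Type w} [Fintype A] (M : φ.Typing A) : Prop where
  not_forbidden : ∀ a b, a ≠ b → ¬ φ.Forbidden (M.T a b)
  sum_msgVec : ∀ a, ∑ b with a ≠ b, φ.msgVec (M.T a b) = φ.C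

open scoped Classical in
/-- The typing of the domain of a structure. -/
noncomputable def _root_.GC2.Struc.typing {A : Type w} (S : Struc φ.UExt B A) : φ.Typing A where
  tp a
    | Sum.inl p => decide (S.un p a)
    | Sum.inr r => decide (S.bin r a a)
  T a b
    | Sum.inl (p, c) => decide (S.un p (asg a b c))
    | Sum.inr (r, c, d) => decide (S.bin r (asg a b c) (asg a b d))
  T_inv a b _ := by
    funext c
    rcases c with ⟨p, c⟩ | ⟨r, c, d⟩
    · cases c <;> rfl
    · cases c <;> cases d <;> rfl
  tp₁_T a b _ := by
    funext c
    rcases c with p | r <;> rfl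

theorem holds_typing {A : Type w} (S : Struc φ.UExt B A) (a b : A) :
    (S.typing.T a b).Holds S a b := by
  constructor <;> simp [Struc.typing]

theorem sum_msgVec_apply {A : Type w} [Fintype A] (T : A → φ.TwoTp) (P : A → Prop)
    [DecidablePred P] (i : Fin φ.m) :
    (∑ b with P b, φ.msgVec (T b)) i =
      Nat.card {b // T b (Sum.inr (φ.f i, Vr.x, Vr.y)) = true ∧ P b} := by
  classical
  rw [Finset.sum_apply, Nat.card_eq_fintype_card, Fintype.card_subtype]
  simp only [msgVec, Finset.sum_boole, Finset.filter_filter, Nat.cast_id]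
  congr 2
  ext b
  exact and_comm

theorem isModel_typing {A : Type} [Fintype A] (S : Struc φ.UExt B A)
    (g : Vr → A) (h : φ.toFormula.Realize (φ.reduct S) g) : (S.typing).IsModel := by
  obtain ⟨h₁, h₂, h₃⟩ := (φ.realize_toFormula_iff _ _).1 h
  constructor
  · intro a b hab
    refine not_not.2 ⟨A, S, a, b, ?_, ?_, fun h => h₂ h a b hab, fun h => h₂ h b a hab.symm,
      holds_typing S a b⟩
    · exact (φ.realize_α_congr _ _ _ _ _ _ (fun _ => Iff.rfl) fun _ => Iff.rfl).1 (h₁ a)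
    · exact (φ.realize_α_congr _ _ _ _ _ _ (fun _ => Iff.rfl) fun _ => Iff.rfl).1 (h₁ b)
  · intro a
    funext i
    rw [sum_msgVec_apply]
    have h := h₃ i a
    have hT : ∀ b, S.typing.T a b (Sum.inr (φ.f i, Vr.x, Vr.y)) = true ↔
        (φ.reduct S).bin (φ.f i) a b := fun b => (holds_typing S a b).2 _ _ _
    simp only [hT]
    have h' := congrArg ENat.toNat h
    rwa [ENat.toNat_natCast, ← Set.ncard_def, ← Nat.card_coe_set_eq] at h'

open scoped Classical in
theorem Typing.IsModel.finitelySatisfiable {A : Type} [Fintype A] [Nonempty A]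
    {M : φ.Typing A} (hM : M.IsModel) : φ.toFormula.FinitelySatisfiable := by
  let S : Struc φ.UExt B A :=
    { un := fun p a => M.tp a (Sum.inl p) = true
      bin := fun r a b => if a = b then M.tp a (Sum.inr r) = true
        else M.T a b (Sum.inr (r, Vr.x, Vr.y)) = true }
  have htp : ∀ a b, a ≠ b → ∀ q, (M.T a b).tp₁ q = M.tp a q := fun a b h q => by
    rw [M.tp₁_T a b h]
  have htp' : ∀ a b, a ≠ b → ∀ q, (M.T a b).tp₂ q = M.tp b q := fun a b h q => by
    rw [M.tp₂_T h]
  have hS : ∀ a b, a ≠ b → (M.T a b).Holds S a b := by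
    intro a b hab
    constructor
    · intro p c
      cases c
      · simp only [asg, S, ← htp a b hab]; rfl
      · simp only [asg, S, ← htp' a b hab]; rfl
    · intro r c d
      cases c <;> cases d
      · simp only [asg, S, if_true, ← htp a b hab]; rfl
      · simp [asg, S, hab]
      · simp only [asg, S, if_neg hab.symm, M.T_inv a b hab]; rfl
      · simp only [asg, S, if_true, ← htp' a b hab]; rfl
  -- Since some `C i` is positive, no element is alone. Thus each lies in a non-forbidden two-type,
  -- and this yields `α` at that element.
  have hne : ∀ a : A, ∃ b, a ≠ b := by
    intro a
    by_contra hc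
    push Not at hc
    have h := congrFun (hM.sum_msgVec a) ⟨0, φ.m_pos⟩
    have h' := φ.C_pos ⟨0, φ.m_pos⟩
    rw [← h, Finset.filter_false_of_mem (by simpa using hc)] at h'
    simp at h'
  refine ⟨A, inferInstance, inferInstance, φ.reduct S, fun g => ?_⟩
  have hun : ∀ {A' : Type} {S' : Struc φ.UExt B A'} {a b : A} {a' b' : A'},
      (M.T a b).Holds S' a' b' → a ≠ b → ∀ p c,
      S'.un p (asg a' b' c) ↔ S.un p (asg a b c) :=
    fun h hab p c => (h.1 p c).symm.trans ((hS _ _ hab).1 p c)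
  have hbin : ∀ {A' : Type} {S' : Struc φ.UExt B A'} {a b : A} {a' b' : A'},
      (M.T a b).Holds S' a' b' → a ≠ b → ∀ r c d,
      S'.bin r (asg a' b' c) (asg a' b' d) ↔ S.bin r (asg a b c) (asg a b d) :=
    fun h hab r c d => (h.2 r c d).symm.trans ((hS _ _ hab).2 r c d)
  rw [realize_toFormula_iff]
  refine ⟨fun a => ?_, fun h a b hab he => ?_, fun i a => ?_⟩
  · obtain ⟨b, hab⟩ := hne a
    obtain ⟨A', S', a', b', hα, -, -, -, hH⟩ := not_not.1 (hM.not_forbidden a b hab)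
    refine (φ.realize_α_congr _ _ _ _ _ _ (fun p => ?_) fun r => ?_).1 hα
    · exact hun hH hab (Sum.inl p) Vr.x
    · exact hbin hH hab r Vr.x Vr.x
  · obtain ⟨A', S', a', b', -, -, hβ, -, hH⟩ := not_not.1 (hM.not_forbidden a b hab)
    refine (Formula.realize_congr _ _ _ _ _ (φ.β_qf h) ?_ ?_).1
      (hβ h ((hbin hH hab _ Vr.x Vr.y).2 he))
    · exact fun p c _ => hun hH hab (Sum.inl p) c
    · exact fun r c _ d _ => hbin hH hab r c d
  · have h := congrFun (hM.sum_msgVec a) i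
    rw [sum_msgVec_apply] at h
    rw [← h, ← Set.coe_ofPred, Nat.card_coe_set_eq, (Set.toFinite _).cast_ncard_eq]
    congr 1
    ext b
    refine and_congr_left fun hab => ?_
    exact ((hS a b hab).2 (φ.f i) Vr.x Vr.y).symm

end NormalForm

/-! ### Colouring and rich models. -/

/-- Greedy colouring of a relation with more colours than the degree of each element. -/
theorem exists_coloring_of_card_lt {A K : Type*} [Finite A] [Finite K] (R : A → A → Prop)
    (hsymm : ∀ a b, R a b → R b a) (hirr : ∀ a, ¬ R a a)
    (hdeg : ∀ a, {b | R a b}.ncard < Nat.card K) :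
    ∃ c : A → K, ∀ a b, R a b → c a ≠ c b := by
  classical
  have := Fintype.ofFinite A
  suffices h : ∀ s : Finset A, ∃ c : A → K, ∀ a ∈ s, ∀ b ∈ s, R a b → c a ≠ c b by
    obtain ⟨c, hc⟩ := h Finset.univ
    exact ⟨c, fun a b => hc a (Finset.mem_univ a) b (Finset.mem_univ b)⟩
  intro s
  induction s using Finset.induction_on with
  | empty =>
    by_cases hA : Nonempty A
    · obtain ⟨a⟩ := hA
      have : Nonempty K := (Nat.card_pos_iff.1 ((Nat.zero_le _).trans_lt (hdeg a))).1
      exact ⟨fun _ => this.some, by simp⟩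
    · exact ⟨fun a => (hA ⟨a⟩).elim, by simp⟩
  | insert a s ha ih =>
    obtain ⟨c, hc⟩ := ih
    -- The neighbours of `a` cannot use up all the colours.
    obtain ⟨k, hk⟩ : ∃ k, k ∉ c '' {b | R a b} := by
      by_contra h
      push Not at h
      have h1 : c '' {b | R a b} = Set.univ := Set.eq_univ_of_forall h
      have h2 := Set.ncard_image_le (f := c) (Set.toFinite {b | R a b})
      rw [h1, Set.ncard_univ] at h2
      exact absurd (hdeg a) h2.not_gt
    refine ⟨Function.update c a k, ?_⟩
    have key : ∀ b ∈ s, R a b → c b ≠ k := fun b _ hR he => hk ⟨b, hR, he⟩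
    have hne : ∀ b ∈ s, b ≠ a := fun b hb h => ha (h ▸ hb)
    intro b hb d hd hR
    rcases Finset.mem_insert.1 hb with rfl | hb' <;>
      rcases Finset.mem_insert.1 hd with rfl | hd'
    · exact (hirr _ hR).elim
    · rw [Function.update_self, Function.update_of_ne (hne d hd')]
      exact (key d hd' hR).symm
    · rw [Function.update_self, Function.update_of_ne (hne b hb')]
      exact key b hb' (hsymm _ _ hR)
    · rw [Function.update_of_ne (hne b hb'), Function.update_of_ne (hne d hd')]
      exact hc b hb' d hd' hR

/-- A symmetric relation of degree at most `D` has a colouring with `D ^ 2 + 1` colours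
separating elements at distance at most two. -/
theorem exists_coloring_dist_two {A K : Type*} [Finite A] [Finite K] (R : A → A → Prop)
    (hsymm : ∀ a b, R a b → R b a) (hirr : ∀ a, ¬ R a a) (D : ℕ)
    (hD : ∀ a, {b | R a b}.ncard ≤ D) (hK : D ^ 2 < Nat.card K) :
    ∃ c : A → K, (∀ a b, R a b → c a ≠ c b) ∧
      ∀ a b d, R a b → R a d → b ≠ d → c b ≠ c d := by
  classical
  have := Fintype.ofFinite A
  -- Greedy colouring of the relation "at distance one or two", whose degree is at most `D + D * (D
  -- - 1) = D ^ 2`.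
  obtain ⟨c, hc⟩ := exists_coloring_of_card_lt (K := K)
    (fun a b => a ≠ b ∧ (R a b ∨ ∃ d, R a d ∧ R d b))
    (by
      rintro a b ⟨h, h' | ⟨d, h1, h2⟩⟩
      · exact ⟨h.symm, .inl (hsymm _ _ h')⟩
      · exact ⟨h.symm, .inr ⟨d, hsymm _ _ h2, hsymm _ _ h1⟩⟩)
    (fun a h => h.1 rfl) (by
      intro a
      refine lt_of_le_of_lt ?_ hK
      let N : A → Finset A := fun a => Finset.univ.filter (R a)
      have hN : ∀ a, (N a).card ≤ D := fun a => by
        rw [← Set.ncard_coe_finset]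
        simpa [N] using hD a
      have hsub : {b | a ≠ b ∧ (R a b ∨ ∃ d, R a d ∧ R d b)} ⊆
          ↑(N a ∪ (N a).biUnion fun d => (N d).erase a) := by
        rintro b ⟨h, h' | ⟨d, h1, h2⟩⟩
        · simp [N, h']
        · simp only [Finset.coe_union, Set.mem_union, Finset.mem_coe, Finset.mem_biUnion]
          exact .inr ⟨d, by simpa [N] using h1, by simpa [N, h2] using h.symm⟩
      refine (Set.ncard_le_ncard hsub (Finset.finite_toSet _)).trans ?_
      rw [Set.ncard_coe_finset]
      refine (Finset.card_union_le _ _).trans ?_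
      -- By symmetry `a` is itself a neighbour of `d`, so `d` contributes at most `D - 1` others.
      have hb : ((N a).biUnion fun d => (N d).erase a).card ≤ (N a).card * (D - 1) := by
        refine Finset.card_biUnion_le_card_mul _ _ _ fun d hd => ?_
        rw [Finset.card_erase_of_mem (by simpa [N] using hsymm _ _ (by simpa [N] using hd))]
        exact Nat.sub_le_sub_right (hN d) 1
      rcases Nat.eq_zero_or_pos D with h0 | h0
      · have := hN a
        subst h0
        simp only [Nat.le_zero] at this
        rw [this] at hb ⊢
        simpa using hb
      · calc (N a).card + _ ≤ (N a).card + (N a).card * (D - 1) := Nat.add_le_add_left hb _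
          _ = (N a).card * (D - 1 + 1) := by ring
          _ ≤ D * D := by rw [Nat.sub_add_cancel h0]; exact Nat.mul_le_mul_right _ (hN a)
          _ = D ^ 2 := (sq D).symm)
  refine ⟨c, fun a b h => hc a b ⟨fun h' => hirr a (by rwa [← h'] at h), .inl h⟩, ?_⟩
  exact fun a b d h h' hne => hc b d ⟨hne, .inr ⟨a, hsymm _ _ h, h'⟩⟩

namespace NormalForm

variable {φ : NormalForm U B}

theorem maxC_pos (φ : NormalForm U B) : 0 < φ.maxC :=
  (φ.C_pos ⟨0, φ.m_pos⟩).trans_le (Finset.le_sup (f := φ.C) (Finset.mem_univ _))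

theorem sum_C_le (φ : NormalForm U B) : ∑ i, φ.C i ≤ φ.m * φ.maxC := by
  have := Finset.sum_le_card_nsmul Finset.univ φ.C φ.maxC fun i hi => Finset.le_sup hi
  simpa using this

/-- Every one-type that occurs does so often, and distinct elements at distance at most two with
respect to invertible messages have distinct one-types. -/
structure Typing.IsRich {A : Type w} (M : φ.Typing A) : Prop where
  large : ∀ a, 3 * φ.m * φ.maxC ≤ Nat.card {b // M.tp b = M.tp a}
  tp_ne : ∀ a b, a ≠ b → φ.IsInvertible (M.T a b) → M.tp a ≠ M.tp b
  tp_ne₂ : ∀ a b c, a ≠ b → a ≠ c → b ≠ c → φ.IsInvertible (M.T a b) →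
    φ.IsInvertible (M.T a c) → M.tp b ≠ M.tp c

theorem exists_rich_model (h : φ.toFormula.FinitelySatisfiable) :
    ∃ (A : Type) (_ : Fintype A) (_ : Nonempty A) (M : φ.Typing A), M.IsModel ∧ M.IsRich := by
  classical
  obtain ⟨A, hA, hne, S, hS⟩ := h
  have := Fintype.ofFinite A
  obtain ⟨a₀⟩ := hne
  obtain ⟨h₁, h₂, h₃⟩ := (φ.realize_toFormula_iff _ _).1 (hS fun _ => a₀)
  let R : A → A → Prop := fun a b => a ≠ b ∧ (∃ i, S.bin (φ.f i) a b) ∧ ∃ i, S.bin (φ.f i) b a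
  have hdeg : ∀ a, {b | R a b}.ncard ≤ φ.m * φ.maxC := by
    intro a
    have hsub : {b | R a b} ⊆ ⋃ i, {b | S.bin (φ.f i) a b ∧ a ≠ b} := by
      rintro b ⟨h, ⟨i, hi⟩, -⟩
      exact Set.mem_iUnion.2 ⟨i, hi, h⟩
    refine (Set.ncard_le_ncard hsub).trans (le_trans ?_ φ.sum_C_le)
    refine (Set.ncard_iUnion_le_of_fintype _).trans (Finset.sum_le_sum fun i _ => ?_)
    rw [Set.ncard_def, h₃, ENat.toNat_natCast]
  -- A colour is a bit vector, later read as the truth values of the new unary predicates; there are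
  -- `2 ^ φ.numNew` of them, at least $(mC)^2+1$.
  obtain ⟨c, hc₁, hc₂⟩ := exists_coloring_dist_two (K := Fin φ.numNew → Bool) R
    (fun a b h => ⟨h.1.symm, h.2.2, h.2.1⟩) (fun a h => h.1 rfl) (φ.m * φ.maxC) hdeg (by
      have := Nat.le_pow_clog one_lt_two ((φ.m * φ.maxC) ^ 2 + 1)
      simpa [numNew] using this)
  let n := 3 * φ.m * φ.maxC
  have hn : 0 < n := Nat.mul_pos (Nat.mul_pos (by norm_num) φ.m_pos) φ.maxC_pos
  -- Distinct copies are unrelated, so no guard `e h` or `f i` holds across copies and the formula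
  -- stays true.
  let S' : Struc φ.UExt B (A × Fin n) :=
    { un := fun p a => Sum.elim (fun p => S.un p a.1) (fun k => c a.1 k = true) p
      bin := fun r a b => a.2 = b.2 ∧ S.bin r a.1 b.1 }
  have htp : ∀ a b : A × Fin n, S'.typing.tp a = S'.typing.tp b → c a.1 = c b.1 := by
    intro a b hab
    funext k
    have := congrFun hab (Sum.inl (Sum.inr k))
    simp only [Struc.typing, S', Sum.elim_inr] at this
    exact Bool.eq_iff_iff.2 (decide_eq_decide.1 this)
  have hmsg : ∀ a b : A × Fin n, φ.IsInvertible (S'.typing.T a b) → a ≠ b →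
      a.2 = b.2 ∧ R a.1 b.1 := by
    rintro a b ⟨⟨i, hi⟩, ⟨j, hj⟩⟩ hab
    have hi := ((holds_typing S' a b).2 _ _ _).1 hi
    have hj := ((holds_typing S' a b).2 _ _ _).1 hj
    exact ⟨hi.1, fun h => hab (Prod.ext h hi.1), ⟨i, hi.2⟩, ⟨j, hj.2⟩⟩
  refine ⟨A × Fin n, inferInstance, ⟨(a₀, ⟨0, hn⟩)⟩, S'.typing,
    isModel_typing S' (fun _ => (a₀, ⟨0, hn⟩)) ?_, ?_, ?_, ?_⟩
  · rw [realize_toFormula_iff]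
    refine ⟨fun a => ?_, fun h a b hab he => ?_, fun i a => ?_⟩
    · exact (φ.realize_α_congr S (φ.reduct S') a.1 a₀ a _ (fun _ => Iff.rfl)
        fun _ => (and_iff_right rfl).symm).1 (h₁ a.1)
    · have hab' : a.1 ≠ b.1 := fun h => hab (Prod.ext h he.1)
      have he1 : a.2 = b.2 := he.1
      refine (Formula.realize_congr _ _ _ _ _ (φ.β_qf h) ?_ ?_).1 (h₂ h a.1 b.1 hab' he.2)
      · intro p c _
        cases c <;> exact Iff.rfl
      · intro r c _ d _
        cases c <;> cases d <;> simp [reduct, S', asg, he1]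
    · rw [← h₃ i a.1]
      refine Eq.trans ?_ ((Prod.mk_left_injective a.2).encard_image
        {b | S.bin (φ.f i) a.1 b ∧ a.1 ≠ b})
      refine congrArg Set.encard (Set.ext fun ⟨b, k⟩ => ?_)
      simp only [reduct, S', Set.mem_ofPred_eq, Set.mem_image, Prod.mk.injEq]
      constructor
      · rintro ⟨⟨h, h'⟩, h''⟩
        exact ⟨b, ⟨h', fun hab => h'' (Prod.ext hab h)⟩, rfl, h⟩
      · rintro ⟨b, ⟨h, h'⟩, rfl, rfl⟩
        exact ⟨⟨rfl, h⟩, fun hab => h' (congrArg Prod.fst hab)⟩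
  · intro a
    have hinj : Function.Injective (fun k : Fin n =>
        (⟨(a.1, k), by
          funext q
          rcases q with p | r <;> simp [Struc.typing, S']⟩ :
          {b // S'.typing.tp b = S'.typing.tp a})) := by
      intro k k' h
      simpa using h
    simpa using Nat.card_le_card_of_injective _ hinj
  · intro a b hab hi h
    exact hc₁ _ _ (hmsg a b hi hab).2 (htp a b h)
  · intro a b d hab had hbd hb hd h
    have h1 := hmsg a b hb hab
    have h2 := hmsg a d hd had
    refine hc₂ _ _ _ h1.2 h2.2 (fun h => hbd (Prod.ext h (h1.1.symm.trans h2.1))) (htp b d h)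

end NormalForm

/-! ### From a rich model to a solution. -/

theorem card_subtype_eq_sum_of_unique {X Λ : Type*} [Finite X] (P : X → Prop) (Q : Λ → X → Prop)
    (K : Finset Λ) (h : ∀ a, P a ↔ ∃ k ∈ K, Q k a) (hu : ∀ a k k', Q k a → Q k' a → k = k') :
    Nat.card {a // P a} = ∑ k ∈ K, Nat.card {a // Q k a} := by
  rw [← Finset.sum_coe_sort K, ← Nat.card_sigma]
  refine (Nat.card_congr (Equiv.ofBijective (fun q => ⟨q.2.1, (h _).2 ⟨q.1, q.1.2, q.2.2⟩⟩)
    ⟨?_, ?_⟩)).symm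
  · rintro ⟨⟨k, hk⟩, a, ha⟩ ⟨⟨k', hk'⟩, a', ha'⟩ heq
    obtain rfl : a = a' := congrArg Subtype.val heq
    obtain rfl := hu _ _ _ ha ha'
    rfl
  · rintro ⟨a, ha⟩
    obtain ⟨k, hk, hQ⟩ := (h a).1 ha
    exact ⟨⟨⟨k, hk⟩, a, hQ⟩, rfl⟩

namespace NormalForm

variable {φ : NormalForm U B}

theorem msgVec_eq_zero_iff {τ : φ.TwoTp} : φ.msgVec τ = 0 ↔ ¬ φ.IsMessage τ := by
  simp [funext_iff, msgVec]

theorem msgVec_pos {τ : φ.TwoTp} (h : φ.IsMessage τ) : 0 < φ.msgVec τ :=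
  pos_iff_ne_zero.2 fun h' => msgVec_eq_zero_iff.1 h' h

theorem Typing.IsRich.eq_of_tp_eq {A : Type w} {M : φ.Typing A} (hR : M.IsRich) {a b c : A} (hb : a ≠ b)
    (hc : a ≠ c) (hb' : φ.IsInvertible (M.T a b)) (hc' : φ.IsInvertible (M.T a c))
    (h : M.tp b = M.tp c) : b = c :=
  by_contra fun hne => hR.tp_ne₂ a b c hb hc hne hb' hc' h

set_option linter.unusedSectionVars false

variable [Fintype U] [DecidableEq U] [Fintype B] [DecidableEq B]

section

variable {A : Type w} [Fintype A] (M : φ.Typing A) (E : φ.Enumeration)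

open scoped Classical in
/-- The numbers of invertible messages sent by an element to those of the `j`th one-type. -/
noncomputable def Typing.invVec (j : Fin (2 ^ φ.p)) (a : A) : Fin φ.m → ℕ :=
  ∑ b with a ≠ b ∧ φ.IsInvertible (M.T a b) ∧ M.tp b = E.pi j, φ.msgVec (M.T a b)

open scoped Classical in
/-- The numbers of messages of type `μ_{π,j}` sent by an element. -/
noncomputable def Typing.nonInvVec (π : φ.OneTp) (j : Fin (2 ^ φ.q)) (a : A) : Fin φ.m → ℕ :=
  ∑ b with a ≠ b ∧ M.T a b = (E.mu π j).1, φ.msgVec (M.T a b)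

open scoped Classical in
theorem Typing.sum_invVec (a : A) : ∑ j, M.invVec E j a =
    ∑ b with a ≠ b ∧ φ.IsInvertible (M.T a b), φ.msgVec (M.T a b) := by
  rw [← Finset.sum_fiberwise (Finset.univ.filter _) (fun b => E.pi.symm (M.tp b))]
  refine Finset.sum_congr rfl fun j _ => ?_
  rw [Typing.invVec, Finset.filter_filter]
  refine Finset.sum_congr (Finset.filter_congr fun b _ => ?_) fun _ _ => rfl
  rw [Equiv.symm_apply_eq]
  exact and_assoc.symm

open scoped Classical in
theorem Typing.sum_nonInvVec (a : A) : ∑ j, M.nonInvVec E (M.tp a) j a =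
    ∑ b with a ≠ b ∧ ¬ φ.IsMessage (M.T a b).inv, φ.msgVec (M.T a b) := by
  have hj : ∀ b, a ≠ b → ¬ φ.IsMessage (M.T a b).inv →
      ∃ j, (E.mu (M.tp a) j).1 = M.T a b := fun b hab h =>
    ⟨(E.mu (M.tp a)).symm ⟨M.T a b, M.tp₁_T a b hab, h⟩, by simp⟩
  simp only [Typing.nonInvVec]
  rw [Finset.sum_sigma']
  refine Finset.sum_bij (fun q _ => q.2) ?_ ?_ ?_ ?_
  · rintro ⟨j, b⟩ h
    simp only [Finset.mem_sigma, Finset.mem_filter, Finset.mem_univ, true_and] at h ⊢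
    exact ⟨h.1, h.2 ▸ (E.mu (M.tp a) j).2.2⟩
  · rintro ⟨j, b⟩ h ⟨j', b'⟩ h' heq
    simp only [Finset.mem_sigma, Finset.mem_filter, Finset.mem_univ, true_and] at h h' heq
    subst heq
    obtain rfl := (E.mu (M.tp a)).injective (Subtype.ext (h.2.symm.trans h'.2))
    rfl
  · intro b hb
    simp only [Finset.mem_filter, Finset.mem_univ, true_and] at hb
    obtain ⟨j, hj⟩ := hj b hb.1 hb.2
    exact ⟨⟨j, b⟩, by simp [hb.1, hj], rfl⟩
  · exact fun _ _ => rfl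

variable {M}

/-- Every message is either invertible or not, and silent two-types contribute the zero vector. This
is the source of the equation linking the roots of the two trees. -/
theorem Typing.IsModel.sum_add_sum (hM : M.IsModel) (a : A) :
    ∑ j, M.invVec E j a + ∑ j, M.nonInvVec E (M.tp a) j a = φ.C := by
  classical
  rw [M.sum_invVec, M.sum_nonInvVec, ← hM.sum_msgVec a,
    ← Finset.sum_filter_add_sum_filter_not (Finset.univ.filter fun b => a ≠ b)
      (fun b => φ.IsMessage (M.T a b).inv), Finset.filter_filter, Finset.filter_filter]
  congr 1
  · refine Finset.sum_subset_zero_on_sdiff ?_ ?_ fun _ _ => rfl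
    · intro b
      simp only [Finset.mem_filter]
      exact fun h => ⟨h.1, h.2.1, h.2.2.2⟩
    · intro b hb
      simp only [Finset.mem_sdiff, Finset.mem_filter, Finset.mem_univ, true_and] at hb
      exact msgVec_eq_zero_iff.2 fun h => hb.2 ⟨hb.1.1, h, hb.1.2⟩

variable (M)

open scoped Classical in
/-- The numbers of elements and pairs of elements counted by the variables. -/
noncomputable def Typing.count : φ.Var → ℕ
  | .x l => Nat.card {c : A × A // c.1 ≠ c.2 ∧ M.T c.1 c.2 = l.1}
  | .y π s u => Nat.card {a : {a // M.tp a = π} // ∑ j with InSeg s j, M.invVec E j a.1 = u.1}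
  | .z π t u =>
    Nat.card {a : {a // M.tp a = π} // ∑ j with InSeg t j, M.nonInvVec E π j a.1 = u.1}
  | .yHat π s v w => Nat.card {a : {a // M.tp a = π} //
      ∑ j with InSeg (s.ext false) j, M.invVec E j a.1 = v.1 ∧
      ∑ j with InSeg (s.ext true) j, M.invVec E j a.1 = w.1}
  | .zHat π t v w => Nat.card {a : {a // M.tp a = π} //
      ∑ j with InSeg (t.ext false) j, M.nonInvVec E π j a.1 = v.1 ∧
      ∑ j with InSeg (t.ext true) j, M.nonInvVec E π j a.1 = w.1}

variable {M}

theorem Typing.IsModel.sum_invVec_le (hM : M.IsModel) (a : A) : ∑ j, M.invVec E j a ≤ φ.C :=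
  le_self_add.trans_eq (hM.sum_add_sum E a)

theorem Typing.IsModel.sum_nonInvVec_le (hM : M.IsModel) (a : A) :
    ∑ j, M.nonInvVec E (M.tp a) j a ≤ φ.C :=
  le_add_self.trans_eq (hM.sum_add_sum E a)

theorem Typing.IsModel.treeCounts_inv (hM : M.IsModel) (π : φ.OneTp) :
    TreeCounts φ.C φ.p (fun s u => M.count E (.y π s u))
      (fun s v w => M.count E (.yHat π s v w)) :=
  treeCounts_of_leaves (X := {a // M.tp a = π}) (fun j a => M.invVec E j a.1)
    fun a => hM.sum_invVec_le E a.1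

theorem Typing.IsModel.treeCounts_nonInv (hM : M.IsModel) (π : φ.OneTp) :
    TreeCounts φ.C φ.q (fun s u => M.count E (.z π s u))
      (fun s v w => M.count E (.zHat π s v w)) :=
  treeCounts_of_leaves (X := {a // M.tp a = π}) (fun j a => M.nonInvVec E π j a.1)
    (by rintro ⟨a, rfl⟩; exact hM.sum_nonInvVec_le E a)

theorem Typing.IsModel.sum_count_eps (hM : M.IsModel) (π : φ.OneTp) :
    ∑ u, M.count E (.y π (eps φ.p) u) = Nat.card {a // M.tp a = π} := by
  classical
  simp only [Typing.count, inSeg_eps, Finset.filter_true]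
  let g : {a // M.tp a = π} → φ.Vec := fun a => ⟨_, hM.sum_invVec_le E a.1⟩
  have h := card_subtype_eq_sum_fiber (fun _ : {a // M.tp a = π} => True) g Finset.univ (by simp)
  rw [Nat.card_congr (Equiv.subtypeUnivEquiv fun _ => trivial)] at h
  rw [h]
  refine Finset.sum_congr (by congr!) fun u _ => ?_
  simp only [true_and, g, Subtype.ext_iff]

-- A leaf stands for one receiving one-type, and in a rich model an element sends at most one
-- invertible message to it. So a nonzero leaf vector is that of a single message, and counting
-- senders is counting pairs.
open scoped Classical in
theorem Typing.IsRich.count_leaf (hR : M.IsRich) (π : φ.OneTp) (s : BitString φ.p) (u : φ.Vec)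
    (hs : s.1.length = φ.p) (hu : 0 < u.1) : M.count E (.y π s u) =
      ∑ l : φ.InvType with E.InLambda π s l ∧ φ.msgVec l.1 = u.1, M.count E (.x l) := by
  obtain ⟨j₀, hj₀⟩ := exists_inSeg_iff_eq s hs
  simp only [Typing.count, hj₀, Finset.filter_eq', Finset.mem_univ, if_true,
    Finset.sum_singleton]
  have key : ∀ a b, a ≠ b → φ.IsInvertible (M.T a b) → M.tp b = E.pi j₀ →
      M.invVec E j₀ a = φ.msgVec (M.T a b) := by
    intro a b hab hi hb
    rw [Typing.invVec, Finset.sum_eq_single b]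
    · intro c hc hcb
      simp only [Finset.mem_filter, Finset.mem_univ, true_and] at hc
      exact absurd (hR.eq_of_tp_eq hc.1 hab hc.2.1 hi (hc.2.2.trans hb.symm)) hcb
    · intro h
      exact absurd (by simp only [Finset.mem_filter, Finset.mem_univ, true_and];
                       exact ⟨hab, hi, hb⟩) h
  let P : A × A → Prop := fun c => c.1 ≠ c.2 ∧ M.tp c.1 = π ∧ φ.IsInvertible (M.T c.1 c.2) ∧
    M.tp c.2 = E.pi j₀ ∧ φ.msgVec (M.T c.1 c.2) = u.1
  have h1 : Nat.card {a : {a // M.tp a = π} // M.invVec E j₀ a.1 = u.1} = Nat.card {c // P c} := by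
    refine (Nat.card_congr (Equiv.ofBijective (fun c => ⟨⟨c.1.1, c.2.2.1⟩,
      (key _ _ c.2.1 c.2.2.2.1 c.2.2.2.2.1).trans c.2.2.2.2.2⟩) ⟨?_, ?_⟩)).symm
    · rintro ⟨⟨a, b⟩, h⟩ ⟨⟨a', b'⟩, h'⟩ heq
      obtain rfl : a = a' := congrArg (fun x => x.1.1) heq
      have := hR.eq_of_tp_eq h.1 h'.1 h.2.2.1 h'.2.2.1 (h.2.2.2.1.trans h'.2.2.2.1.symm)
      simp only at this
      subst this
      rfl
    · rintro ⟨⟨a, ha⟩, h⟩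
      obtain ⟨b, hb, -⟩ := Finset.exists_ne_zero_of_sum_ne_zero
        (by rw [← Typing.invVec, h]; exact hu.ne' :
          ∑ b with a ≠ b ∧ φ.IsInvertible (M.T a b) ∧ M.tp b = E.pi j₀, φ.msgVec (M.T a b) ≠ 0)
      simp only [Finset.mem_filter, Finset.mem_univ, true_and] at hb
      exact ⟨⟨(a, b), hb.1, ha, hb.2.1, hb.2.2, (key a b hb.1 hb.2.1 hb.2.2).symm.trans h⟩, rfl⟩
  rw [h1]
  refine card_subtype_eq_sum_of_unique _ (fun (l : φ.InvType) (c : A × A) =>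
    c.1 ≠ c.2 ∧ M.T c.1 c.2 = l.1) _ ?_ fun c l l' h h' => Subtype.ext (h.2.symm.trans h'.2)
  rintro ⟨a, b⟩
  simp only [Finset.mem_filter, Finset.mem_univ, true_and, Enumeration.InLambda, hj₀,
    Equiv.symm_apply_eq, P]
  constructor
  · rintro ⟨hab, ha, hi, hb, hu⟩
    refine ⟨⟨_, hi⟩, ⟨⟨(M.tp₁_T a b hab).trans ha, (M.tp₂_T hab).trans hb⟩, hu⟩, hab, rfl⟩
  · rintro ⟨⟨l, hi⟩, ⟨⟨ha, hb⟩, hu⟩, hab, rfl⟩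
    exact ⟨hab, (M.tp₁_T a b hab).symm.trans ha, hi, (M.tp₂_T hab).symm.trans hb, hu⟩

theorem Typing.nonInvVec_eq (π : φ.OneTp) (j : Fin (2 ^ φ.q)) (a : A) :
    ∃ n : ℕ, M.nonInvVec E π j a = n • φ.msgVec (E.mu π j).1 := by
  classical
  refine ⟨_, (Finset.sum_congr rfl fun b hb => ?_).trans (Finset.sum_const _)⟩
  rw [(Finset.mem_filter.1 hb).2.2]

theorem Typing.exists_of_nonInvVec_ne_zero {π : φ.OneTp} {j : Fin (2 ^ φ.q)} {a : A}
    (h : M.nonInvVec E π j a ≠ 0) : ∃ b, a ≠ b ∧ M.T a b = (E.mu π j).1 := by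
  classical
  obtain ⟨b, hb, -⟩ := Finset.exists_ne_zero_of_sum_ne_zero h
  exact ⟨b, (Finset.mem_filter.1 hb).2⟩

theorem Typing.exists_of_count_leaf_pos {π : φ.OneTp} {t : BitString φ.q} {u : φ.Vec}
    {τ : φ.TwoTp} (ht : t.1.length = φ.q) (hτ : E.InM π t τ)
    (h : M.count E (.z π t u) ≠ 0) : ∃ a j, (E.mu π j).1 = τ ∧ M.nonInvVec E π j a = u.1 := by
  obtain ⟨j₀, hj₀⟩ := exists_inSeg_iff_eq t ht
  obtain ⟨j, hj, hτ⟩ := hτ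
  obtain rfl := (hj₀ j).1 hj
  simp only [Typing.count, hj₀, Finset.filter_eq', Finset.mem_univ, if_true,
    Finset.sum_singleton] at h
  obtain ⟨⟨a, ha⟩⟩ := (Nat.card_ne_zero.1 h).1
  exact ⟨a.1, j, hτ, ha⟩

/-- Richness enters only in `y_leaf`, `x_chromatic` and `z_large`; the other constraints hold for
the counts in any nonempty model. -/
theorem Typing.IsModel.isSolution [Nonempty A] (hM : M.IsModel) (hR : M.IsRich) :
    φ.IsSolution E (M.count E) where
  z_eps π u := by
    simp only [Typing.count, inSeg_eps, Finset.filter_true]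
    congr 2
    ext ⟨a, rfl⟩
    have h := hM.sum_add_sum E a
    simp only [funext_iff, Vec.compl] at h ⊢
    refine forall_congr' fun i => ?_
    have h1 := h i
    have h2 : u.1 i ≤ φ.C i := u.2 i
    simp only [Pi.add_apply] at h1
    omega
  y_split π s u := by
    convert (hM.treeCounts_inv E π).split s u
  z_split π s u := by
    convert (hM.treeCounts_nonInv E π).split s u
  y_left π s u := by
    convert (hM.treeCounts_inv E π).left s u
  y_right π s u := by
    convert (hM.treeCounts_inv E π).right s u
  z_left π s u := by
    convert (hM.treeCounts_nonInv E π).left s u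
  z_right π s u := by
    convert (hM.treeCounts_nonInv E π).right s u
  nonempty := by
    obtain ⟨a⟩ := ‹Nonempty A›
    have : Nonempty {b // M.tp b = M.tp a} := ⟨⟨a, rfl⟩⟩
    refine (Nat.card_pos (α := {b // M.tp b = M.tp a})).trans_le ?_
    rw [← hM.sum_count_eps E]
    exact Finset.single_le_sum (f := fun π => ∑ u, M.count E (.y π (eps φ.p) u))
      (fun _ _ => Nat.zero_le _) (Finset.mem_univ _)
  y_leaf π s u hs hu := by
    convert hR.count_leaf E π s u hs hu
  z_leaf π t u τ ht hu hτ hn := by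
    by_contra h
    obtain ⟨a, j, rfl, ha⟩ := Typing.exists_of_count_leaf_pos E ht hτ h
    obtain ⟨n, hn'⟩ := M.nonInvVec_eq E π j a
    exact hn ⟨n, ha.symm.trans hn'⟩
  x_inv l := by
    refine Nat.card_congr ((Equiv.prodComm A A).subtypeEquiv fun c => ?_)
    simp only [Equiv.prodComm_apply, Prod.fst_swap, Prod.snd_swap, ne_comm]
    refine and_congr_right fun h => ?_
    rw [M.T_inv _ _ h]
    constructor
    · intro h'
      rw [h']
      exact TwoType.inv_inv _
    · intro h'
      rw [← TwoType.inv_inv (M.T c.1 c.2), h']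
      rfl
  x_chromatic l hl := by
    by_contra h
    obtain ⟨⟨⟨a, b⟩, hab, hT⟩⟩ := (Nat.card_ne_zero.1 h).1
    refine hR.tp_ne a b hab (hT ▸ l.2) ?_
    rwa [← hT, M.tp₁_T a b hab, M.tp₂_T hab] at hl
  x_forbidden l hl := by
    by_contra h
    obtain ⟨⟨⟨a, b⟩, hab, hT⟩⟩ := (Nat.card_ne_zero.1 h).1
    exact hM.not_forbidden a b hab (hT ▸ hl)
  z_forbidden π t u τ ht hu hτ hf := by
    by_contra h
    obtain ⟨a, j, rfl, ha⟩ := Typing.exists_of_count_leaf_pos E ht hτ h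
    obtain ⟨b, hab, hT⟩ := Typing.exists_of_nonInvVec_ne_zero E (ha.trans_ne hu.ne')
    exact hM.not_forbidden a b hab (hT ▸ hf)
  z_large π t u τ ht hu hτ h := by
    obtain ⟨a, j, rfl, ha⟩ := Typing.exists_of_count_leaf_pos E ht hτ h.ne'
    obtain ⟨b, hab, hT⟩ := Typing.exists_of_nonInvVec_ne_zero E (ha.trans_ne hu.ne')
    rw [← hT, M.tp₂_T hab, hM.sum_count_eps E]
    exact hR.large b

end

end NormalForm

/-! ### Building a model from messages. -/

theorem exists_injective_of_card_fiber_le {X Y V : Type*} [Finite X] [Finite Y]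
    (c : X → V) (d : Y → V) (h : ∀ v, Nat.card {x // c x = v} ≤ Nat.card {y // d y = v}) :
    ∃ t : X → Y, Function.Injective t ∧ ∀ x, d (t x) = c x := by
  have := Fintype.ofFinite X
  have := Fintype.ofFinite Y
  classical
  have e : ∀ v, {x // c x = v} ↪ {y // d y = v} := fun v =>
    (Function.Embedding.nonempty_of_card_le
      (by simpa only [Nat.card_eq_fintype_card] using h v)).some
  refine ⟨fun x => (e (c x) ⟨x, rfl⟩).1, fun x x' hx => ?_, fun x => (e (c x) ⟨x, rfl⟩).2⟩
  have key : ∀ v w (a : {x // c x = v}) (b : {x // c x = w}), (e v a).1 = (e w b).1 →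
      a.1 = b.1 := by
    intro v w a b hab
    have hvw : v = w := by rw [← (e v a).2, hab, (e w b).2]
    subst hvw
    exact congrArg Subtype.val ((e v).injective (Subtype.ext hab))
  exact key _ _ _ _ hx

/-- Three classes allow a cyclic sending rule under which no two elements send to each other. A
fibre of size at least `3 * N` contains a copy of `Fin 3 × Fin N`; its remaining elements go to
class `0`. -/
theorem exists_three_classes {X V : Type*} [Finite X] (c : X → V) (N : ℕ) :
    ∃ cls : X → Fin 3, ∀ v, 3 * N ≤ Nat.card {x // c x = v} →
      ∀ k, N ≤ Nat.card {x // c x = v ∧ cls x = k} := by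
  classical
  have := Fintype.ofFinite X
  have h : ∀ v, ∃ cls : {x // c x = v} → Fin 3, 3 * N ≤ Nat.card {x // c x = v} →
      ∀ k, N ≤ Nat.card {x // cls x = k} := by
    intro v
    by_cases hv : 3 * N ≤ Nat.card {x // c x = v}
    · obtain ⟨e⟩ := Function.Embedding.nonempty_of_card_le
        (α := Fin 3 × Fin N) (β := {x // c x = v}) (by simpa using hv)
      refine ⟨Function.extend e Prod.fst fun _ => 0, fun _ k => ?_⟩
      have := Nat.card_le_card_of_injective
        (fun i : Fin N => (⟨e (k, i), e.injective.extend_apply _ _ _⟩ :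
          {x // Function.extend e Prod.fst (fun _ => 0) x = k})) fun i i' h => by
            simpa using h
      simpa using this
    · exact ⟨fun _ => 0, fun h => (hv h).elim⟩
  choose cls hcls using h
  refine ⟨fun x => cls (c x) ⟨x, rfl⟩, fun v hv k => (hcls v hv k).trans ?_⟩
  refine Nat.card_le_card_of_injective (fun x => ⟨x.1.1, x.1.2, ?_⟩) ?_
  · obtain ⟨⟨x, rfl⟩, hx⟩ := x
    exact hx
  · intro x x' h
    simp only [Subtype.mk.injEq] at h
    exact Subtype.ext (Subtype.ext h)

namespace NormalForm

variable {φ : NormalForm U B}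

theorem forbidden_inv {τ : φ.TwoTp} (h : φ.Forbidden τ.inv) : φ.Forbidden τ := by
  rintro ⟨A, S, a, b, h1, h2, h3, h4, h5⟩
  refine h ⟨A, S, b, a, h2, h1, h4, h3, fun p c => ?_, fun r c d => ?_⟩
  · cases c
    · exact h5.1 p Vr.y
    · exact h5.1 p Vr.x
  · cases c <;> cases d
    · exact h5.2 r Vr.y Vr.y
    · exact h5.2 r Vr.y Vr.x
    · exact h5.2 r Vr.x Vr.y
    · exact h5.2 r Vr.x Vr.x

/-- The two-type with given one-types and no atom `r(x, y)` or `r(y, x)`. -/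
def emptyType (φ : NormalForm U B) (π ρ : φ.OneTp) : φ.TwoTp
  | Sum.inl (p, Vr.x) => π (Sum.inl p)
  | Sum.inl (p, Vr.y) => ρ (Sum.inl p)
  | Sum.inr (r, Vr.x, Vr.x) => π (Sum.inr r)
  | Sum.inr (r, Vr.y, Vr.y) => ρ (Sum.inr r)
  | Sum.inr (_, Vr.x, Vr.y) => false
  | Sum.inr (_, Vr.y, Vr.x) => false

theorem emptyType_inv (π ρ : φ.OneTp) : (φ.emptyType π ρ).inv = φ.emptyType ρ π := by
  funext a
  rcases a with ⟨p, a⟩ | ⟨r, a, b⟩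
  · cases a <;> rfl
  · cases a <;> cases b <;> rfl

theorem tp₁_emptyType (π ρ : φ.OneTp) : (φ.emptyType π ρ).tp₁ = π := by
  funext a
  rcases a with p | r <;> rfl

theorem not_isMessage_emptyType (π ρ : φ.OneTp) : ¬ φ.IsMessage (φ.emptyType π ρ) := by
  rintro ⟨i, hi⟩
  simp [emptyType] at hi

/-- With no atom between the two elements all guards fail, and only `α` is left at each end; it
depends on the one-type alone. -/
theorem not_forbidden_emptyType {τ τ' : φ.TwoTp} (h : ¬ φ.Forbidden τ) (h' : ¬ φ.Forbidden τ') :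
    ¬ φ.Forbidden (φ.emptyType τ.tp₁ τ'.tp₁) := by
  obtain ⟨A, S, a, b, hα, -, -, -, hH⟩ := not_not.1 h
  obtain ⟨A', S', a', b', hα', -, -, -, hH'⟩ := not_not.1 h'
  let R : Struc φ.UExt B Vr :=
    { un := fun p c => φ.emptyType τ.tp₁ τ'.tp₁ (Sum.inl (p, c)) = true
      bin := fun r c d => φ.emptyType τ.tp₁ τ'.tp₁ (Sum.inr (r, c, d)) = true }
  refine not_not.2 ⟨Vr, R, Vr.x, Vr.y, ?_, ?_, ?_, ?_, ?_⟩
  · refine (φ.realize_α_congr _ _ _ _ _ _ (fun p => ?_) fun r => ?_).1 hα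
    · exact (hH.1 (Sum.inl p) Vr.x).symm
    · exact (hH.2 r Vr.x Vr.x).symm
  · refine (φ.realize_α_congr _ _ _ _ _ _ (fun p => ?_) fun r => ?_).1 hα'
    · exact (hH'.1 (Sum.inl p) Vr.x).symm
    · exact (hH'.2 r Vr.x Vr.x).symm
  · intro h he
    simp [R, emptyType] at he
  · intro h he
    simp [R, emptyType] at he
  · constructor
    · intro p c
      cases c <;> exact Iff.rfl
    · intro r c d
      cases c <;> cases d <;> exact Iff.rfl

variable [Fintype U] [DecidableEq U] [Fintype B] [DecidableEq B]

open scoped Classical in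
/-- The messages sent between the elements of a finite set extend to a model. -/
theorem finitelySatisfiable_of_messages {A : Type} [Fintype A] [Nonempty A] (tp : A → φ.OneTp)
    (D : A → A → φ.TwoTp → Prop)
    (htp : ∀ a b τ, D a b τ → τ.tp₁ = tp a ∧ τ.tp₂ = tp b)
    (hmsg : ∀ a b τ, D a b τ → φ.IsMessage τ ∧ ¬ φ.Forbidden τ)
    (hne : ∀ a b τ, D a b τ → a ≠ b)
    (huniq : ∀ a b τ τ', D a b τ → D a b τ' → τ = τ')
    (hinv : ∀ a b τ τ', D a b τ → D b a τ' → τ' = τ.inv)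
    (hsymm : ∀ a b τ, D a b τ → φ.IsMessage τ.inv → D b a τ.inv)
    (hsum : ∀ a, ∑ c : A × φ.TwoTp with D a c.1 c.2, φ.msgVec c.2 = φ.C) :
    φ.toFormula.FinitelySatisfiable := by
  -- The type of a pair is the message sent along it, or the transpose of the message sent back, or
  -- the empty type.
  let Q : A → A → φ.TwoTp → Prop := fun a b τ => D a b τ ∨ D b a τ.inv ∨
    ((∀ τ, ¬ D a b τ) ∧ (∀ τ, ¬ D b a τ) ∧ τ = φ.emptyType (tp a) (tp b))
  have hQ : ∀ a b, ∃ τ, Q a b τ := by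
    intro a b
    by_cases h : ∃ τ, D a b τ
    · exact ⟨h.choose, .inl h.choose_spec⟩
    by_cases h' : ∃ τ, D b a τ
    · exact ⟨h'.choose.inv, .inr (.inl (by rw [TwoType.inv_inv]; exact h'.choose_spec))⟩
    · push Not at h h'
      exact ⟨_, .inr (.inr ⟨h, h', rfl⟩)⟩
  have hQu : ∀ a b τ τ', Q a b τ → Q a b τ' → τ = τ' := by
    rintro a b τ τ' (h | h | ⟨h, h2, rfl⟩) (h' | h' | ⟨h', h2', rfl⟩)
    · exact huniq _ _ _ _ h h'
    · rw [← TwoType.inv_inv τ', hinv _ _ _ _ h h', TwoType.inv_inv]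
    · exact (h' _ h).elim
    · rw [← TwoType.inv_inv τ, hinv _ _ _ _ h' h, TwoType.inv_inv]
    · rw [← TwoType.inv_inv τ, huniq _ _ _ _ h h', TwoType.inv_inv]
    · exact (h2' _ h).elim
    · exact (h _ h').elim
    · exact (h2 _ h').elim
    · rfl
  have hQs : ∀ a b τ, Q a b τ → Q b a τ.inv := by
    rintro a b τ (h | h | ⟨h, h2, rfl⟩)
    · exact .inr (.inl (by rwa [TwoType.inv_inv]))
    · exact .inl h
    · exact .inr (.inr ⟨h2, h, emptyType_inv _ _⟩)
  choose T hT using hQ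
  -- Each element sends some message, as `C` is positive. Hence its one-type lies in a non-forbidden
  -- two-type, as `not_forbidden_emptyType` needs.
  have hD : ∀ a, ∃ b τ, D a b τ := by
    intro a
    by_contra hc
    push Not at hc
    have h := congrFun (hsum a) ⟨0, φ.m_pos⟩
    have h' := φ.C_pos ⟨0, φ.m_pos⟩
    rw [← h, Finset.filter_false_of_mem fun c _ => hc c.1 c.2] at h'
    simp at h'
  let M : φ.Typing A :=
    { tp := tp
      T := T
      T_inv := fun a b _ => hQu b a _ _ (hT b a) (hQs a b _ (hT a b))
      tp₁_T := by
        intro a b _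
        rcases hT a b with h | h | ⟨-, -, h⟩
        · exact (htp _ _ _ h).1
        · rw [← (htp _ _ _ h).2, TwoType.tp₂_inv]
        · rw [h, tp₁_emptyType] }
  have hM : M.IsModel := by
    constructor
    · intro a b _
      change ¬ φ.Forbidden (T a b)
      rcases hT a b with h | h | ⟨-, -, h⟩
      · exact (hmsg _ _ _ h).2
      · exact fun hf => (hmsg _ _ _ h).2 (forbidden_inv (by rwa [TwoType.inv_inv]))
      · obtain ⟨a', τ, hτ⟩ := hD a
        obtain ⟨b', τ', hτ'⟩ := hD b
        rw [h, ← (htp _ _ _ hτ).1, ← (htp _ _ _ hτ').1]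
        exact not_forbidden_emptyType (hmsg _ _ _ hτ).2 (hmsg _ _ _ hτ').2
    · intro a
      rw [← hsum a]
      symm
      refine Finset.sum_of_injOn Prod.fst ?_ ?_ ?_ ?_
      · rintro ⟨b, τ⟩ h ⟨b', τ'⟩ h' heq
        simp only [Finset.coe_filter, Finset.mem_univ, true_and, Set.mem_ofPred_eq] at h h' heq
        subst heq
        rw [huniq _ _ _ _ h h']
      · rintro ⟨b, τ⟩ h
        simp only [Finset.coe_filter, Finset.mem_univ, true_and, Set.mem_ofPred_eq] at h ⊢
        exact hne _ _ _ h
      · intro b _ hb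
        have hb : ∀ τ, ¬ D a b τ := by
          intro τ h
          exact hb ⟨(b, τ), by simpa using h, rfl⟩
        refine msgVec_eq_zero_iff.2 fun hm => ?_
        change φ.IsMessage (T a b) at hm
        rcases hT a b with h | h | ⟨-, -, h⟩
        · exact hb _ h
        · have := hsymm _ _ _ h (by rwa [TwoType.inv_inv])
          exact hb _ this
        · rw [h] at hm
          exact not_isMessage_emptyType _ _ hm
      · rintro ⟨b, τ⟩ h
        simp only [Finset.mem_filter, Finset.mem_univ, true_and] at h
        change _ = φ.msgVec (T a b)
        rw [hQu a b _ _ (hT a b) (.inl h)]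
  exact hM.finitelySatisfiable

end NormalForm

/-! ### Reading elements and messages off a solution. -/

theorem TreeCounts.exists_leaves_family {ι X V : Type*} [Fintype ι] [Finite X] {C : ι → ℕ}
    {n : ℕ} {Y : V → BitString n → ↥(Set.Iic C) → ℕ}
    {Yh : V → ShortString n → ↥(Set.Iic C) → ↥(Set.Iic C) → ℕ}
    (hY : ∀ π, TreeCounts C n (Y π) (Yh π)) (tp : X → V) (f : X → ↥(Set.Iic C))
    (hf : ∀ π u, Nat.card {a : {a // tp a = π} // f a.1 = u} = Y π (eps n) u) :
    ∃ w : Fin (2 ^ n) → X → ↥(Set.Iic C), (∀ a, ∑ j, (w j a).1 = (f a).1) ∧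
      ∀ π (t : BitString n), t.1.length = n → ∀ j, InSeg t j →
        ∀ u, Nat.card {a : {a // tp a = π} // w j a.1 = u} = Y π t u := by
  choose w hw hc using fun π => (hY π).exists_leaves (X := {a // tp a = π}) (fun a => f a.1) (hf π)
  refine ⟨fun j a => w (tp a) j ⟨a, rfl⟩, fun a => hw (tp a) ⟨a, rfl⟩, fun π t ht j hj u => ?_⟩
  rw [← hc π t ht j hj u]
  congr 2
  ext ⟨a, rfl⟩
  rfl

namespace NormalForm

variable {φ : NormalForm U B}

theorem msgVec_le (τ : φ.TwoTp) : φ.msgVec τ ≤ φ.C := by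
  intro i
  have := φ.C_pos i
  change (if _ then 1 else 0) ≤ φ.C i
  split
  · exact this
  · exact Nat.zero_le _

theorem one_le_sum_of_pos {m : ℕ} {u : Fin m → ℕ} (hu : 0 < u) : 1 ≤ ∑ i, u i := by
  by_contra h
  have h : ∑ i, u i = 0 := by omega
  exact hu.ne' (funext fun i => Finset.sum_eq_zero_iff.1 h i (Finset.mem_univ i))

theorem InvType.inv_inv (l : φ.InvType) : l.inv.inv = l :=
  Subtype.ext (TwoType.inv_inv l.1)

set_option linter.unusedSectionVars false

variable [Fintype U] [DecidableEq U] [Fintype B] [DecidableEq B]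

namespace IsSolution

variable {E : φ.Enumeration} {θ : φ.Var → ℕ}

theorem treeCounts_y (hθ : φ.IsSolution E θ) (π : φ.OneTp) :
    TreeCounts φ.C φ.p (fun s u => θ (.y π s u)) (fun s v w => θ (.yHat π s v w)) where
  split s u := by convert hθ.y_split π s u
  left s u := by convert hθ.y_left π s u
  right s u := by convert hθ.y_right π s u

theorem treeCounts_z (hθ : φ.IsSolution E θ) (π : φ.OneTp) :
    TreeCounts φ.C φ.q (fun s u => θ (.z π s u)) (fun s v w => θ (.zHat π s v w)) where
  split s u := by convert hθ.z_split π s u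
  left s u := by convert hθ.z_left π s u
  right s u := by convert hθ.z_right π s u

/-- Elements with a one-type and a vector counting the invertible messages they send. -/
theorem exists_domain (hθ : φ.IsSolution E θ) :
    ∃ (A : Type) (_ : Fintype A) (_ : Nonempty A) (tp : A → φ.OneTp) (f : A → φ.Vec),
      ∀ π u, Nat.card {a : {a // tp a = π} // f a.1 = u} = θ (.y π (eps φ.p) u) := by
  -- One-types are represented by their indices so that the domain lives in `Type`.
  refine ⟨Σ (j : Fin (2 ^ φ.p)) (u : φ.Vec), Fin (θ (.y (E.pi j) (eps φ.p) u)),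
    inferInstance, ?_, fun a => E.pi a.1, fun a => a.2.1, fun π u => ?_⟩
  · by_contra hemp
    rw [not_nonempty_iff] at hemp
    have h := hθ.nonempty
    rw [Finset.sum_eq_zero] at h
    · omega
    · intro π _
      refine Finset.sum_eq_zero fun u _ => ?_
      obtain ⟨j, rfl⟩ := E.pi.surjective π
      by_contra h0
      exact hemp.elim ⟨j, u, ⟨0, Nat.pos_of_ne_zero h0⟩⟩
  · obtain ⟨j, rfl⟩ := E.pi.surjective π
    conv_rhs => rw [← Nat.card_fin (θ (.y (E.pi j) (eps φ.p) u))]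
    refine (Nat.card_congr (Equiv.ofBijective (fun i => ⟨⟨⟨j, u, i⟩, rfl⟩, rfl⟩) ⟨?_, ?_⟩)).symm
    · intro i i' h
      simpa using h
    · rintro ⟨⟨⟨j', u', i⟩, hj⟩, hu⟩
      obtain rfl := E.pi.injective hj
      obtain rfl : u' = u := hu
      exact ⟨i, rfl⟩

variable {A : Type} [Fintype A] {tp : A → φ.OneTp} {f : A → φ.Vec}

open scoped Classical in
/-- The distribution of invertible message-types to the elements sending them. -/
theorem exists_senders (hθ : φ.IsSolution E θ)
    (hf : ∀ π u, Nat.card {a : {a // tp a = π} // f a.1 = u} = θ (.y π (eps φ.p) u)) :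
    ∃ R : φ.InvType → A → Prop,
      (∀ l a, R l a → l.1.tp₁ = tp a) ∧
      (∀ l l' a, R l a → R l' a → l.1.tp₂ = l'.1.tp₂ → l = l') ∧
      (∀ l, Nat.card {a // R l a} = θ (.x l)) ∧
      ∀ a, ∑ l with R l a, φ.msgVec l.1 = (f a).1 := by
  obtain ⟨w, hw, hc⟩ := TreeCounts.exists_leaves_family hθ.treeCounts_y tp f hf
  let V : φ.InvType → φ.Vec := fun l => ⟨φ.msgVec l.1, msgVec_le l.1⟩
  have hV : ∀ l, 0 < (V l).1 := fun l => msgVec_pos l.2.1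
  -- Each element and leaf with nonzero vector receives an invertible type with the same sender
  -- type, leaf and vector. The leaf equations supply the required fibre sizes; for the zero vector
  -- both sides are zero.
  obtain ⟨L, hL, hx⟩ := exists_lift_of_card_fiber
    (X := {c : Fin (2 ^ φ.p) × A // 0 < (w c.1 c.2).1})
    (fun l : φ.InvType => (l.1.tp₁, E.pi.symm l.1.tp₂, V l))
    (fun c => (tp c.1.2, c.1.1, w c.1.1 c.1.2)) (fun l => θ (.x l)) (by
      rintro ⟨π, j, u⟩
      by_cases hu : 0 < u.1
      · obtain ⟨t, ⟨ht, hj⟩, -⟩ := existsUnique_inSeg j φ.p le_rfl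
        obtain ⟨j₀, hj₀⟩ := exists_inSeg_iff_eq t ht
        obtain rfl := (hj₀ j).1 hj
        trans θ (.y π t u)
        · rw [← hc π t ht j hj u]
          refine (Nat.card_congr (Equiv.ofBijective (fun a => ⟨⟨(j, a.1.1), a.2.symm ▸ hu⟩,
            Prod.ext a.1.2 (Prod.ext rfl a.2)⟩) ⟨?_, ?_⟩)).symm
          · rintro ⟨⟨a, ha⟩, h⟩ ⟨⟨a', ha'⟩, h'⟩ heq
            simp only [Subtype.mk.injEq, Prod.mk.injEq, true_and] at heq
            subst heq
            rfl
          · rintro ⟨⟨⟨j', a⟩, h⟩, h'⟩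
            simp only [Prod.mk.injEq] at h'
            obtain ⟨h1, rfl, h3⟩ := h'
            exact ⟨⟨⟨a, h1⟩, h3⟩, rfl⟩
        · rw [hθ.y_leaf π t u ht hu]
          refine Finset.sum_congr ?_ fun _ _ => rfl
          ext l
          simp only [Finset.mem_filter, Finset.mem_univ, true_and, Enumeration.InLambda, hj₀,
            Prod.mk.injEq, Subtype.ext_iff, V, and_assoc]
      · rw [Finset.filter_false_of_mem, Finset.sum_empty, Nat.card_eq_zero]
        · left
          refine ⟨?_⟩
          rintro ⟨⟨c, h⟩, h'⟩
          simp only [Prod.mk.injEq] at h'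
          rw [h'.2.2] at h
          exact hu h
        · intro l _ h
          simp only [Prod.mk.injEq] at h
          exact hu (h.2.2 ▸ hV l))
  simp only [Prod.mk.injEq] at hL
  refine ⟨fun l a => ∃ j h, L ⟨(j, a), h⟩ = l, ?_, ?_, ?_, ?_⟩
  · rintro _ a ⟨j, h, rfl⟩
    exact (hL _).1
  · rintro _ _ a ⟨j, h, rfl⟩ ⟨j', h', rfl⟩ heq
    have h1 := (hL ⟨(j, a), h⟩).2.1
    have h2 := (hL ⟨(j', a), h'⟩).2.1
    rw [heq] at h1
    obtain rfl : j = j' := h1.symm.trans h2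
    rfl
  · intro l
    rw [← hx l]
    refine (Nat.card_congr (Equiv.ofBijective
      (fun c => ⟨c.1.1.2, c.1.1.1, c.1.2, c.2⟩) ⟨?_, ?_⟩)).symm
    · rintro ⟨⟨⟨j, a⟩, h⟩, h1⟩ ⟨⟨⟨j', a'⟩, h'⟩, h2⟩ heq
      obtain rfl : a = a' := congrArg Subtype.val heq
      have h3 := (hL ⟨(j, a), h⟩).2.1
      have h4 := (hL ⟨(j', a), h'⟩).2.1
      rw [h1] at h3
      rw [h2] at h4
      obtain rfl : j = j' := h3.symm.trans h4
      rfl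
    · rintro ⟨a, j, h, h'⟩
      exact ⟨⟨⟨(j, a), h⟩, h'⟩, rfl⟩
  · intro a
    rw [← hw a, ← Finset.sum_filter_of_ne (p := fun j => 0 < (w j a).1)
      (fun j _ h => pos_iff_ne_zero.2 h)]
    symm
    refine Finset.sum_bij (fun j hj => L ⟨(j, a), (Finset.mem_filter.1 hj).2⟩) ?_ ?_ ?_ ?_
    · intro j hj
      simp only [Finset.mem_filter, Finset.mem_univ, true_and]
      exact ⟨j, _, rfl⟩
    · intro j hj j' hj' heq
      have h3 := (hL ⟨(j, a), (Finset.mem_filter.1 hj).2⟩).2.1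
      have h4 := (hL ⟨(j', a), (Finset.mem_filter.1 hj').2⟩).2.1
      rw [heq] at h3
      exact h3.symm.trans h4
    · intro l hl
      simp only [Finset.mem_filter, Finset.mem_univ, true_and] at hl
      obtain ⟨j, h, rfl⟩ := hl
      exact ⟨j, by simpa using h, rfl⟩
    · intro j hj
      exact (congrArg Subtype.val (hL ⟨(j, a), (Finset.mem_filter.1 hj).2⟩).2.2).symm

open scoped Classical in
/-- The pairing of the senders of each invertible message-type with those of its inverse. -/
theorem exists_links (hθ : φ.IsSolution E θ)
    (hf : ∀ π u, Nat.card {a : {a // tp a = π} // f a.1 = u} = θ (.y π (eps φ.p) u)) :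
    ∃ K : φ.InvType → A → A → Prop,
      (∀ l a b, K l a b → l.1.tp₁ = tp a ∧ l.1.tp₂ = tp b ∧ a ≠ b ∧ ¬ φ.Forbidden l.1) ∧
      (∀ l a b, K l a b → K l.inv b a) ∧
      (∀ l l' a b b', K l a b → K l' a b' → tp b = tp b' → l = l' ∧ b = b') ∧
      ∀ a, ∑ l with ∃ b, K l a b, φ.msgVec l.1 = (f a).1 := by
  obtain ⟨R, hR₁, hR₂, hR₃, hR₄⟩ := hθ.exists_senders hf
  -- The senders of `l` are numbered from `0` to `θ (.x l) - 1`. A sender of `l` will be linked to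
  -- the sender of `l.inv` with the same number, which exists by `x_inv`.
  have hidx : ∀ l, ∃ idx : A → ℕ, (∀ a, R l a → idx a < θ (.x l)) ∧
      (∀ a b, R l a → R l b → idx a = idx b → a = b) ∧
      ∀ k < θ (.x l), ∃ a, R l a ∧ idx a = k := by
    intro l
    have e : {a // R l a} ≃ Fin (θ (.x l)) :=
      (Finite.card_eq.1 ((hR₃ l).trans (Nat.card_fin _).symm)).some
    refine ⟨fun a => if h : R l a then e ⟨a, h⟩ else 0, fun a h => ?_, fun a b ha hb h => ?_,
      fun k hk => ⟨(e.symm ⟨k, hk⟩).1, (e.symm ⟨k, hk⟩).2, ?_⟩⟩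
    · simp [h]
    · simp only [ha, hb, dite_true] at h
      exact congrArg Subtype.val (e.injective (Fin.ext h))
    · simp [(e.symm ⟨k, hk⟩).2]
  choose idx hlt hinj hsurj using hidx
  have hpos : ∀ l a, R l a → 0 < θ (.x l) := fun l a h => (Nat.zero_le _).trans_lt (hlt l a h)
  have htp₂ : ∀ (l : φ.InvType) b, R l.inv b → l.1.tp₂ = tp b := fun l b h => hR₁ _ _ h
  refine ⟨fun l a b => R l a ∧ R l.inv b ∧ idx l a = idx l.inv b, ?_, ?_, ?_, ?_⟩
  · rintro l a b ⟨ha, hb, -⟩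
    refine ⟨hR₁ l a ha, htp₂ l b hb, ?_, fun h => (hpos l a ha).ne' (hθ.x_forbidden l h)⟩
    -- A self-link would give `l` equal end types, which `x_chromatic` excludes.
    rintro rfl
    exact (hpos l a ha).ne' (hθ.x_chromatic l ((hR₁ l a ha).trans (htp₂ l a hb).symm))
  · rintro l a b ⟨ha, hb, h⟩
    exact ⟨hb, by rwa [InvType.inv_inv], by rw [InvType.inv_inv, h]⟩
  · rintro l l' a b b' ⟨ha, hb, h⟩ ⟨ha', hb', h'⟩ heq
    have hl := hR₂ l l' a ha ha' (by rw [htp₂ l b hb, htp₂ l' b' hb', heq])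
    subst hl
    exact ⟨rfl, hinj _ _ _ hb hb' (h.symm.trans h')⟩
  · intro a
    rw [← hR₄ a]
    refine Finset.sum_congr (Finset.ext fun l => ?_) fun _ _ => rfl
    simp only [Finset.mem_filter, Finset.mem_univ, true_and]
    constructor
    · rintro ⟨b, h, -⟩
      exact h
    · intro h
      obtain ⟨b, hb, hb'⟩ := hsurj l.inv (idx l a) (by rw [hθ.x_inv]; exact hlt l a h)
      exact ⟨b, h, hb, hb'.symm⟩

/-- The numbers of non-invertible messages of each type sent by the elements. -/
theorem exists_multiplicities (hθ : φ.IsSolution E θ)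
    (hf : ∀ π u, Nat.card {a : {a // tp a = π} // f a.1 = u} = θ (.y π (eps φ.p) u)) :
    ∃ n : Fin (2 ^ φ.q) → A → ℕ,
      (∀ a, (f a).1 + ∑ j, n j a • φ.msgVec (E.mu (tp a) j).1 = φ.C) ∧
      ∀ j a, 0 < n j a → φ.IsMessage (E.mu (tp a) j).1 ∧ ¬ φ.Forbidden (E.mu (tp a) j).1 ∧
        3 * (φ.m * φ.maxC) ≤ Nat.card {b // tp b = (E.mu (tp a) j).1.tp₂} := by
  classical
  have hcc : ∀ u : φ.Vec, Vec.compl (Vec.compl u) = u := fun u => Subtype.ext (funext fun i =>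
    Nat.sub_sub_self (u.2 i))
  have hz : ∀ π u, Nat.card {a : {a // tp a = π} // Vec.compl (f a.1) = u} =
      θ (.z π (eps φ.q) u) := by
    intro π u
    rw [hθ.z_eps, ← hf]
    congr 2
    ext a
    constructor
    · rintro rfl
      exact (hcc _).symm
    · rintro h
      rw [h, hcc]
  obtain ⟨w, hw, hc⟩ := TreeCounts.exists_leaves_family hθ.treeCounts_z tp
    (fun a => Vec.compl (f a)) hz
  have hcard : ∀ π, ∑ u, θ (.y π (eps φ.p) u) = Nat.card {b // tp b = π} := by
    intro π
    have h := card_subtype_eq_sum_fiber (fun _ : {a // tp a = π} => True) (fun a => f a.1)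
      Finset.univ (by simp)
    rw [Nat.card_congr (Equiv.subtypeUnivEquiv fun _ => trivial)] at h
    rw [h]
    refine Finset.sum_congr (by congr!) fun u _ => ?_
    simp only [true_and, hf]
  have hleaf : ∀ j a, 0 < (w j a).1 → ∃ t : BitString φ.q, t.1.length = φ.q ∧
      E.InM (tp a) t (E.mu (tp a) j).1 ∧ 0 < θ (.z (tp a) t (w j a)) := by
    intro j a _
    obtain ⟨t, ⟨ht, hj⟩, -⟩ := existsUnique_inSeg j φ.q le_rfl
    refine ⟨t, ht, ⟨j, hj, rfl⟩, ?_⟩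
    rw [← hc (tp a) t ht j hj (w j a)]
    have : Nonempty {b : {b // tp b = tp a} // w j b.1 = w j a} := ⟨⟨⟨a, rfl⟩, rfl⟩⟩
    exact Nat.card_pos
  -- For a silent type every multiple is zero, so the choice `0` is imposed when the vector
  -- vanishes; a positive `n` then always means real messages.
  have hn : ∀ j a, ∃ n : ℕ, (w j a).1 = n • φ.msgVec (E.mu (tp a) j).1 ∧
      (0 < n → 0 < (w j a).1) := by
    intro j a
    rcases eq_or_ne (w j a).1 0 with h | h
    · exact ⟨0, by simp [h], by simp⟩
    · have h := pos_iff_ne_zero.2 h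
      obtain ⟨t, ht, hM, hpos⟩ := hleaf j a h
      by_contra hne
      push Not at hne
      refine hpos.ne' (hθ.z_leaf _ t _ _ ht h hM ?_)
      rintro ⟨n, hn⟩
      exact (hne n hn).2 h
  choose n hn hn' using hn
  refine ⟨n, fun a => ?_, fun j a hpos => ?_⟩
  · simp only [← hn, hw]
    funext i
    exact Nat.add_sub_of_le ((f a).2 i)
  · have h := hn' j a hpos
    obtain ⟨t, ht, hM, hpos⟩ := hleaf j a h
    refine ⟨?_, fun hF => hpos.ne' (hθ.z_forbidden _ t _ _ ht h hM hF), ?_⟩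
    · by_contra hm
      rw [hn, msgVec_eq_zero_iff.2 hm, smul_zero] at h
      exact h.ne rfl
    · rw [← hcard, ← mul_assoc]
      exact hθ.z_large _ t _ _ ht h hM hpos

end IsSolution

end NormalForm

/-! ### Choosing receivers and assembling the model. -/

namespace NormalForm

variable {φ : NormalForm U B}

/-- Distinct receivers, in a prescribed class and outside a small set, for a bounded family of
messages. -/
theorem exists_receivers {A I V : Type*} [Finite A] [Finite I] (tp : A → V) (cls : A → Fin 3)
    (k : Fin 3) (ρ : I → V) (P : A → Prop) (N : ℕ)
    (hN : Nat.card I + Nat.card {b // P b} ≤ N)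
    (hρ : ∀ i, N ≤ Nat.card {b // tp b = ρ i ∧ cls b = k}) :
    ∃ t : I → A, Function.Injective t ∧ ∀ i, tp (t i) = ρ i ∧ cls (t i) = k ∧ ¬ P (t i) := by
  -- For each target type that occurs, at least `N` elements have it in class `k`. Removing those in
  -- `P` leaves at least `Nat.card I`, enough even if all messages had this target.
  obtain ⟨t, ht, htp⟩ := exists_injective_of_card_fiber_le (Y := {b // cls b = k ∧ ¬ P b}) ρ
    (fun b => tp b.1) (by
      intro v
      by_cases hv : ∃ i, ρ i = v
      · obtain ⟨i, rfl⟩ := hv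
        refine (Finite.card_subtype_le _).trans ?_
        have h := hρ i
        have hle : Nat.card {b // tp b = ρ i ∧ cls b = k} ≤
            Nat.card ({b // P b} ⊕ {b : {b // cls b = k ∧ ¬ P b} // tp b.1 = ρ i}) := by
          classical
          refine Nat.card_le_card_of_injective (fun b => if h : P b.1 then .inl ⟨b.1, h⟩ else
            .inr ⟨⟨b.1, b.2.2, h⟩, b.2.1⟩) ?_
          rintro ⟨b, hb⟩ ⟨b', hb'⟩ heq
          by_cases h1 : P b <;> by_cases h2 : P b' <;> simp [h1, h2] at heq <;>
            exact Subtype.ext heq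
        rw [Nat.card_sum] at hle
        omega
      · have : IsEmpty {i // ρ i = v} := ⟨fun i => hv ⟨i.1, i.2⟩⟩
        simp)
  refine ⟨fun i => (t i).1, fun i i' h => ht (Subtype.ext h), fun i => ⟨htp i, (t i).2⟩⟩

set_option linter.unusedSectionVars false

variable [Fintype U] [DecidableEq U] [Fintype B] [DecidableEq B]

namespace IsSolution

variable {E : φ.Enumeration} {θ : φ.Var → ℕ}

theorem finitelySatisfiable (hθ : φ.IsSolution E θ) : φ.toFormula.FinitelySatisfiable := by
  classical
  obtain ⟨A, _, _, tp, f, hf⟩ := hθ.exists_domain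
  obtain ⟨K, hK, hKs, hKu, hKf⟩ := hθ.exists_links hf
  obtain ⟨n, hn, hn'⟩ := hθ.exists_multiplicities hf
  obtain ⟨cls, hcls⟩ := exists_three_classes tp (φ.m * φ.maxC)
  -- Each message contributes at least one to the coordinate sum of `φ.C`, so an element sends at
  -- most `φ.m * φ.maxC` messages in all.
  have hcard : ∀ a, Nat.card (Σ j, Fin (n j a)) + Nat.card {b // ∃ l, K l a b} ≤
      φ.m * φ.maxC := by
    intro a
    refine le_trans ?_ φ.sum_C_le
    rw [← hn a, add_comm]
    simp only [Pi.add_apply, Finset.sum_add_distrib]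
    refine add_le_add ?_ ?_
    · have h1 : Nat.card {b // ∃ l, K l a b} ≤ Nat.card {l // ∃ b, K l a b} := by
        refine Nat.card_le_card_of_injective (fun b => ⟨b.2.choose, b.1, b.2.choose_spec⟩) ?_
        intro b b' h
        simp only [Subtype.mk.injEq] at h
        have h2 := b.2.choose_spec
        have h3 := b'.2.choose_spec
        rw [← h] at h3
        exact Subtype.ext (hKu _ _ _ _ _ h2 h3
          ((hK _ _ _ h2).2.1.symm.trans (hK _ _ _ h3).2.1)).2
      refine h1.trans ?_
      rw [← hKf a, Nat.card_eq_fintype_card, Fintype.card_subtype, Finset.card_eq_sum_ones]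
      simp only [Finset.sum_apply]
      rw [Finset.sum_comm]
      exact Finset.sum_le_sum fun l _ => one_le_sum_of_pos (msgVec_pos l.2.1)
    · simp only [Nat.card_sigma, Nat.card_fin, Finset.sum_apply, Pi.smul_apply]
      rw [Finset.sum_comm]
      refine Finset.sum_le_sum fun j _ => ?_
      rw [← Finset.smul_sum, smul_eq_mul]
      rcases Nat.eq_zero_or_pos (n j a) with h | h
      · simp [h]
      · exact Nat.le_mul_of_pos_right _ (one_le_sum_of_pos (msgVec_pos (hn' j a h).1))
  have hpos : ∀ a (i : Σ j, Fin (n j a)), 0 < n i.1 a := fun a i => (Nat.zero_le _).trans_lt i.2.2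
  -- Receivers lie in the next class and avoid the invertible partners of `a`.
  choose t htinj ht using fun a => exists_receivers tp cls (cls a + 1)
    (fun i : Σ j, Fin (n j a) => (E.mu (tp a) i.1).1.tp₂) (fun b => ∃ l, K l a b)
    (φ.m * φ.maxC) (hcard a) fun i => hcls _ (hn' i.1 a (hpos a i)).2.2 _
  -- The first inequality forbids non-invertible messages to oneself, the second forbids them in
  -- both directions between two elements.
  have hsucc : ∀ k : Fin 3, k + 1 ≠ k ∧ k + 1 + 1 ≠ k := by decide
  refine finitelySatisfiable_of_messages tp (fun a b τ => (∃ l : φ.InvType, K l a b ∧ l.1 = τ) ∨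
    ∃ i, t a i = b ∧ (E.mu (tp a) i.1).1 = τ) ?_ ?_ ?_ ?_ ?_ ?_ ?_
  · rintro a b τ (⟨l, h, rfl⟩ | ⟨i, rfl, rfl⟩)
    · exact ⟨(hK l a b h).1, (hK l a b h).2.1⟩
    · exact ⟨(E.mu (tp a) i.1).2.1, (ht a i).1.symm⟩
  · rintro a b τ (⟨l, h, rfl⟩ | ⟨i, rfl, rfl⟩)
    · exact ⟨l.2.1, (hK l a b h).2.2.2⟩
    · exact ⟨(hn' i.1 a (hpos a i)).1, (hn' i.1 a (hpos a i)).2.1⟩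
  · rintro a b τ (⟨l, h, rfl⟩ | ⟨i, rfl, rfl⟩) hab
    · exact (hK l a b h).2.2.1 hab
    · have h := (ht a i).2.1
      rw [← hab] at h
      exact (hsucc _).1 h.symm
  · rintro a b τ τ' (⟨l, h, rfl⟩ | ⟨i, rfl, rfl⟩) (⟨l', h', rfl⟩ | ⟨i', h', rfl⟩)
    · rw [(hKu l l' a b b h h' rfl).1]
    · exact ((ht a i').2.2 ⟨l, h' ▸ h⟩).elim
    · exact ((ht a i).2.2 ⟨l', h'⟩).elim
    · rw [htinj a h']
  · rintro a b τ τ' (⟨l, h, rfl⟩ | ⟨i, rfl, rfl⟩) (⟨l', h', rfl⟩ | ⟨i', h', rfl⟩)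
    · rw [(hKu l' l.inv b a a h' (hKs _ _ _ h) rfl).1]
      rfl
    · exact ((ht b i').2.2 ⟨l.inv, h' ▸ hKs _ _ _ h⟩).elim
    · exact ((ht a i).2.2 ⟨l'.inv, hKs _ _ _ h'⟩).elim
    · have h1 := (ht a i).2.1
      have h2 := (ht _ i').2.1
      rw [h', h1] at h2
      exact ((hsucc _).2 h2.symm).elim
  · rintro a b τ (⟨l, h, rfl⟩ | ⟨i, rfl, rfl⟩) hm
    · exact .inl ⟨l.inv, hKs _ _ _ h, rfl⟩
    · exact ((E.mu (tp a) i.1).2.2 hm).elim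
  · intro a
    trans ∑ c : A × φ.TwoTp with ∃ l : φ.InvType, K l a c.1 ∧ l.1 = c.2, φ.msgVec c.2 +
      ∑ c : A × φ.TwoTp with ∃ i, t a i = c.1 ∧ (E.mu (tp a) i.1).1 = c.2, φ.msgVec c.2
    · rw [← Finset.sum_union, ← Finset.filter_or]
      · congr!
      · rw [Finset.disjoint_filter]
        rintro c - ⟨l, h, -⟩ ⟨i, h', -⟩
        exact (ht a i).2.2 ⟨l, h' ▸ h⟩
    · rw [← hn a]
      congr 1
      · rw [← hKf a]
        symm
        refine Finset.sum_bij (fun l hl => ((Finset.mem_filter.1 hl).2.choose, l.1)) ?_ ?_ ?_ ?_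
        · intro l hl
          simp only [Finset.mem_filter, Finset.mem_univ, true_and]
          exact ⟨l, (Finset.mem_filter.1 hl).2.choose_spec, rfl⟩
        · intro l _ l' _ h
          exact Subtype.ext (congrArg Prod.snd h)
        · rintro ⟨b, τ⟩ hc
          obtain ⟨l, hl, rfl⟩ := (Finset.mem_filter.1 hc).2
          have hex : ∃ b, K l a b := ⟨b, hl⟩
          refine ⟨l, by simpa using hex, Prod.ext ?_ rfl⟩
          exact (hKu _ _ _ _ _ hex.choose_spec hl
            ((hK _ _ _ hex.choose_spec).2.1.symm.trans (hK _ _ _ hl).2.1)).2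
        · exact fun _ _ => rfl
      · have h : ∀ j, n j a • φ.msgVec (E.mu (tp a) j).1 =
            ∑ _i : Fin (n j a), φ.msgVec (E.mu (tp a) j).1 := fun j => by simp
        rw [Finset.sum_congr rfl fun j _ => h j, Finset.sum_sigma']
        symm
        refine Finset.sum_bij (fun i _ => (t a ⟨i.1, i.2⟩, (E.mu (tp a) i.1).1)) ?_ ?_ ?_ ?_
        · intro i _
          simp only [Finset.mem_filter, Finset.mem_univ, true_and]
          exact ⟨i, rfl, rfl⟩
        · intro i _ i' _ h
          exact htinj a (congrArg Prod.fst h)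
        · rintro ⟨b, τ⟩ hc
          obtain ⟨i, hi⟩ := (Finset.mem_filter.1 hc).2
          exact ⟨i, by simp, Prod.ext hi.1 hi.2⟩
        · exact fun _ _ => rfl

end IsSolution

end NormalForm

end GC2

theorem mainTheorem3 {U : Type*} {B : Type*} [Fintype U] [DecidableEq U] [Fintype B]
    [DecidableEq B] (φ : GC2.NormalForm U B) (E : φ.Enumeration) :
    φ.toFormula.FinitelySatisfiable ↔ ∃ θ : φ.Var → ℕ, φ.IsSolution E θ := by
  constructor
  · intro h
    obtain ⟨A, _, _, M, hM, hR⟩ := GC2.NormalForm.exists_rich_model h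
    exact ⟨_, hM.isSolution E hR⟩
  · rintro ⟨θ, hθ⟩
    exact hθ.finitelySatisfiable
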